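/- Let $N\ge 2$ and let $\Omega\subset\mathbb R^N$ be open, bounded and connected, with Lipschitz boundary (near each boundary point, $\Omega$ is, in suitable orthonormal coordinates, the strict subgraph of a Lipschitz function of $N-1$ variables), satisfying the uniform interior sphere condition: there is $r_0>0$ such that for every $x_0\in\partial\Omega$ there is a unit vector $\zeta$ with $B_{r_0}(x_0+r_0\zeta)\subset\Omega$. Let $1<p<\gamma$, $\nu>0$, $c_H>0$, $q\ge 1$ and $q>N/\gamma$. For $\theta\in(0,N]$ the Morrey space $\mathcal L^{1,\theta}(\Omega)$ consists of those $h\in L^1(\Omega)$ for which there is a constant $C$ with $\int_{B_r(z)\cap\Omega}|h|\,dx\le C\,r^{N-\theta}$ for all $z\in\Omega$ and $0<r\le\operatorname{diam}\Omega$; its norm is $$\|h\|_{\mathcal L^{1,\theta}(\Omega)}=\sup_{z\in\Omega,\;0<r\le\operatorname{diam}\Omega} r^{\theta-N}\int_{B_r(z)\cap\Omega}|h|\,dx .$$ Let $\mathcal A:\Omega\times\mathbb R\times\mathbb R^N\to\mathbb R^N$ be a Carathéodory function (measurable in $x$ for every $(s,\xi)$, continuous in $(s,\xi)$ for a.e.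 $x$), let $\mathcal B:\Omega\times\mathbb R\times\mathbb R^N\to\mathbb R$, $\lambda\ge 0$ and $f:\Omega\to\mathbb R$ be such that, for a.e. $x\in\Omega$ and all $(s,\xi)\in\mathbb R\times\mathbb R^N$, $$|\mathcal A(x,s,\xi)|\le\nu|\xi|^{p-1},\qquad \mathcal B(x,s,\xi)\ge c_H|\xi|^\gamma-\lambda s-f(x).$$ Let $u\in W^{1,\gamma}_{\rm loc}(\Omega)$ be a distributional supersolution of $-\operatorname{div}\mathcal A(x,u,\nabla u)\ge\mathcal B(x,u,\nabla u)$ in $\Omega$, that is, $\mathcal A(\cdot,u,\nabla u)\in L^{p/(p-1)}_{\rm loc}(\Omega)$, $\mathcal B(\cdot,u,\nabla u)\in L^1_{\rm loc}(\Omega)$ and $$\int_\Omega\mathcal A(x,u,\nabla u)\cdot\nabla\varphi\,dx\ \ge\ \int_\Omega\mathcal B(x,u,\nabla u)\,\varphi\,dx\qquad\text{for every } 0\le\varphi\in C^1_c(\Omega).$$ Suppose that $f$ and $\lambda u^+$, where $u^+=\max\{u,0\}$, belong to $\mathcal L^{1,N/q}(\Omega)$. Then $u$ is, up to modification on a null set,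 Hölder continuous on $\overline\Omega$: $$|u(x)-u(y)|\le K|x-y|^\alpha\quad\text{for all }x,y\in\overline\Omega,\qquad \alpha=\min\Big\{1-\frac{N}{q\gamma},\ \frac{\gamma-p}{\gamma-(p-1)}\Big\},$$ where $K$ depends only on $p,q,\gamma,N,\nu,c_H,\Omega$ and on an upper bound for $\|f+\lambda u^+\|_{\mathcal L^{1,N/q}(\Omega)}$. In particular, the estimate holds when $f$ and $\lambda u^+$ belong to $L^q(\Omega)$. -/

import Mathlib

open MeasureTheory Set Filter Topology
open scoped ENNReal NNReal Gradient ContDiff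

noncomputable section

namespace QuasilinearHolder

/-- The Euclidean space `ℝ^N` with its Euclidean norm. -/
abbrev E (N : ℕ) : Type := EuclideanSpace ℝ (Fin N)

/-! ### Domains -/

/-- Near each boundary point, `Ω` is the region strictly below the graph of a Lipschitz function `h`
of `N - 1` variables: `e` is the vertical direction, the hyperplane orthogonal to `e` carries the
`N - 1` horizontal variables, and `U` is a neighbourhood of the point. -/
def HasLipschitzBoundary {N : ℕ} (Ω : Set (E N)) : Prop :=
  ∀ x₀ ∈ frontier Ω, ∃ (e : E N) (h : (ℝ ∙ e)ᗮ → ℝ) (L : ℝ≥0) (U : Set (E N)),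
    ‖e‖ = 1 ∧ LipschitzWith L h ∧ U ∈ 𝓝 x₀ ∧
      ∀ x ∈ U, x ∈ Ω ↔ inner ℝ e x < h ((ℝ ∙ e)ᗮ.orthogonalProjectionOnto x)

/-- Uniform interior sphere condition: one radius `r` serves all boundary points. -/
def UniformInteriorSphere {N : ℕ} (Ω : Set (E N)) : Prop :=
  ∃ r : ℝ, 0 < r ∧ ∀ x₀ ∈ frontier Ω, ∃ ζ : E N, ‖ζ‖ = 1 ∧ Metric.ball (x₀ + r • ζ) r ⊆ Ω

/-! ### Function spaces -/

/-- `h ∈ L^s_loc(Ω)`: `h ∈ L^s(K)` for every compact `K ⊆ Ω`. -/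
def MemLpLoc {N : ℕ} {F : Type*} [NormedAddCommGroup F] (h : E N → F) (s : ℝ)
    (Ω : Set (E N)) : Prop :=
  ∀ K : Set (E N), IsCompact K → K ⊆ Ω → MemLp h (ENNReal.ofReal s) (volume.restrict K)

/-- `Du` is the weak gradient of `u` in `Ω`: both are locally integrable in `Ω`, and
`∫ u ∇φ = - ∫ φ Du` for every smooth `φ` with compact support in `Ω`. -/
structure IsWeakGradient {N : ℕ} (Ω : Set (E N)) (u : E N → ℝ) (Du : E N → E N) : Prop where
  memLpLoc_fun : MemLpLoc u 1 Ω
  memLpLoc_grad : MemLpLoc Du 1 Ω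
  integral_eq : ∀ φ : E N → ℝ, ContDiff ℝ ∞ φ → HasCompactSupport φ → tsupport φ ⊆ Ω →
    ∫ x in Ω, u x • ∇ φ x = - ∫ x in Ω, φ x • Du x

/-- `u ∈ W^{1,s}_loc(Ω)`, with weak gradient `Du`. -/
structure MemW1Loc {N : ℕ} (Ω : Set (E N)) (s : ℝ) (u : E N → ℝ) (Du : E N → E N) : Prop where
  isWeakGradient : IsWeakGradient Ω u Du
  memLpLoc_fun : MemLpLoc u s Ω
  memLpLoc_grad : MemLpLoc Du s Ω

/-- The Morrey norm
`sup { r ^ ((θ - N) / s) * ‖h‖_{L^s(B_r(z) ∩ Ω)} : z ∈ Ω, 0 < r ≤ diam Ω }`, as an extended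
nonnegative number. -/
def morreyNorm {N : ℕ} (Ω : Set (E N)) (s θ : ℝ) (h : E N → ℝ) : ℝ≥0∞ :=
  ⨆ (z : E N) (_ : z ∈ Ω) (r : ℝ) (_ : 0 < r ∧ r ≤ Metric.diam Ω),
    ENNReal.ofReal (r ^ ((θ - N) / s)) *
      eLpNorm h (ENNReal.ofReal s) (volume.restrict (Metric.ball z r ∩ Ω))

/-- The Morrey space `𝓛^{s,θ}(Ω)`: functions `h ∈ L^s(Ω)` for which there is a constant `C` with
`∫_{B_r(z) ∩ Ω} |h|^s ≤ C r^(N - θ)` for all `z ∈ Ω` and `0 < r ≤ diam Ω`. -/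
def MemMorrey {N : ℕ} (Ω : Set (E N)) (s θ : ℝ) (h : E N → ℝ) : Prop :=
  MemLp h (ENNReal.ofReal s) (volume.restrict Ω) ∧
    ∃ C : ℝ, ∀ z ∈ Ω, ∀ r : ℝ, 0 < r → r ≤ Metric.diam Ω →
      ∫ x in Metric.ball z r ∩ Ω, |h x| ^ s ≤ C * r ^ ((N : ℝ) - θ)

/-! ### The differential inequality -/

/-- `A : Ω × ℝ × ℝ^N → ℝ^N` is a Carathéodory function (only values over `Ω` matter). -/
structure IsCaratheodory {N : ℕ} (Ω : Set (E N)) (A : E N → ℝ → E N → E N) : Prop where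
  measurable_left : ∀ (s : ℝ) (ξ : E N), AEMeasurable (fun x => A x s ξ) (volume.restrict Ω)
  continuous_right : ∀ᵐ x ∂(volume.restrict Ω), Continuous fun z : ℝ × E N => A x z.1 z.2

/-- Growth of the diffusion: `|A(x,s,ξ)| ≤ ν |ξ|^(p-1)`. -/
def DiffusionGrowth {N : ℕ} (Ω : Set (E N)) (p ν : ℝ) (A : E N → ℝ → E N → E N) : Prop :=
  ∀ᵐ x ∂(volume.restrict Ω), ∀ (s : ℝ) (ξ : E N), ‖A x s ξ‖ ≤ ν * ‖ξ‖ ^ (p - 1)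

/-- Growth of the first-order term: `B(x,s,ξ) ≥ c_H |ξ|^γ - l s - f(x)`. -/
def GradientTermGrowth {N : ℕ} (Ω : Set (E N)) (γ cH l : ℝ) (f : E N → ℝ)
    (B : E N → ℝ → E N → ℝ) : Prop :=
  ∀ᵐ x ∂(volume.restrict Ω), ∀ (s : ℝ) (ξ : E N), cH * ‖ξ‖ ^ γ - l * s - f x ≤ B x s ξ

/-- `u ∈ W^{1,p}_loc(Ω)`, with weak gradient `Du`, is a distributional supersolution of
`-div A(x,u,∇u) ≥ B(x,u,∇u)` in `Ω`. -/
structure IsDistribSupersolution {N : ℕ} (Ω : Set (E N)) (p : ℝ) (A : E N → ℝ → E N → E N)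
    (B : E N → ℝ → E N → ℝ) (u : E N → ℝ) (Du : E N → E N) : Prop where
  memW1Loc : MemW1Loc Ω p u Du
  memLpLoc_diffusion : MemLpLoc (fun x => A x (u x) (Du x)) (p / (p - 1)) Ω
  memLpLoc_term : MemLpLoc (fun x => B x (u x) (Du x)) 1 Ω
  integral_le : ∀ φ : E N → ℝ, ContDiff ℝ 1 φ → HasCompactSupport φ → tsupport φ ⊆ Ω →
    (∀ x, 0 ≤ φ x) →
    ∫ x in Ω, B x (u x) (Du x) * φ x ≤ ∫ x in Ω, inner ℝ (A x (u x) (Du x)) (∇ φ x)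

end QuasilinearHolder

end

/-! The superlinear gradient term gives an energy bound without any information on the size of `u`.
Testing with `η ^ n`, `η` a cutoff between radii `r` and `2r`, the flux is at most `ν |Du|^(p-1)
|∇(η^n)|`. Since `p - 1 < γ`, Young's inequality absorbs it into half of `c_H |Du|^γ η^n`, at the
cost of a power of `r`, while the data are controlled by their Morrey norm. This is
`exists_integral_grad_rpow_le`. Hölder's inequality turns it into `∫_{B_r} |Du| ≤ C r^(N-1+α)` on
interior balls (`exists_integral_norm_grad_le`), and the two error exponents yield the two entries
of the minimum `α`.

Morrey's Dirichlet growth theorem (`exists_ae_eq_locally_holder`), proved by comparing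
mollifications at dyadic scales, then gives a representative that is `α`-Hölder for pairs of points
close together relative to their distance from the complement. The constant is uniform in the
solution.

Such an estimate becomes global on a bounded connected Lipschitz domain
(`exists_holder_of_isInteriorHolder`). Near the boundary, points are moved inwards along the axes of
cones, the steps summing to a geometric series. Compactness and connectedness treat distant pairs. A
McShane extension reaches the closure. -/

namespace QuasilinearHolder

/-! ### Cutoff functions and Young absorption. -/

lemma norm_gradient_eq_norm_fderiv {N : ℕ} (g : E N → ℝ) (x : E N) : ‖∇ g x‖ = ‖fderiv ℝ g x‖ := by
  rw [gradient, LinearIsometryEquiv.norm_map]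

/-- Cutoff functions between concentric balls of radii `r` and `2r`, with gradient `O(1/r)`. -/
lemma exists_cutoff (N : ℕ) : ∃ C : ℝ, 0 ≤ C ∧ ∀ (z : E N) (r : ℝ), 0 < r →
    ∃ η : E N → ℝ, ContDiff ℝ ∞ η ∧ (∀ x, 0 ≤ η x) ∧ (∀ x, η x ≤ 1) ∧
      (∀ x ∈ Metric.closedBall z r, η x = 1) ∧ tsupport η ⊆ Metric.closedBall z (2 * r) ∧
      ∀ x, ‖∇ η x‖ ≤ C / r := by
  let f : ContDiffBump (0 : E N) := ⟨1, 2, one_pos, one_lt_two⟩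
  have hf : ContDiff ℝ ∞ (f : E N → ℝ) := f.contDiff
  have hf1 : Continuous (fderiv ℝ (f : E N → ℝ)) := hf.continuous_fderiv (by simp)
  obtain ⟨C, hC⟩ := hf1.bounded_above_of_compact_support (f.hasCompactSupport.fderiv ℝ)
  refine ⟨C, (norm_nonneg _).trans (hC 0), fun z r hr => ?_⟩
  refine ⟨fun x => f (r⁻¹ • (x - z)), ?_, fun x => f.nonneg, fun x => f.le_one, ?_, ?_, ?_⟩
  · exact hf.comp (by fun_prop : ContDiff ℝ ∞ fun x : E N => r⁻¹ • (x - z))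
  · intro x hx
    apply f.one_of_mem_closedBall
    rw [mem_closedBall_zero_iff, norm_smul, norm_inv, Real.norm_of_nonneg hr.le, inv_mul_le_iff₀ hr]
    simpa [f, dist_eq_norm] using hx
  · refine closure_minimal (fun x hx => ?_) Metric.isClosed_closedBall
    have : r⁻¹ • (x - z) ∈ Metric.ball (0 : E N) 2 := by
      have := f.support_eq (E := E N)
      rw [← this]; exact hx
    rw [mem_ball_zero_iff, norm_smul, norm_inv, Real.norm_of_nonneg hr.le, inv_mul_lt_iff₀ hr] at this
    rw [Metric.mem_closedBall, dist_eq_norm]; linarith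
  · intro x
    rw [norm_gradient_eq_norm_fderiv]
    have h1 : HasFDerivAt (fun x : E N => r⁻¹ • (x - z)) (r⁻¹ • ContinuousLinearMap.id ℝ (E N)) x :=
      ((hasFDerivAt_id x).sub_const z).const_smul r⁻¹
    have h2 := ((hf.differentiable (by simp)) (r⁻¹ • (x - z))).hasFDerivAt.comp x h1
    rw [show (fun x : E N => f (r⁻¹ • (x - z))) = f ∘ (fun x => r⁻¹ • (x - z)) from rfl, h2.fderiv]
    refine (ContinuousLinearMap.opNorm_comp_le _ _).trans ?_
    rw [div_eq_mul_inv]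
    refine mul_le_mul (hC _) ?_ (norm_nonneg _) ((norm_nonneg _).trans (hC 0))
    rw [norm_smul, norm_inv, Real.norm_of_nonneg hr.le]
    exact mul_le_of_le_one_right (inv_nonneg.2 hr.le) ContinuousLinearMap.norm_id_le

lemma gradient_pow {N : ℕ} {η : E N → ℝ} (hη : Differentiable ℝ η) (n : ℕ) (x : E N) :
    ∇ (fun x => η x ^ n) x = (n * η x ^ (n - 1)) • ∇ η x := by
  have := (hη x).hasFDerivAt.pow n
  rw [gradient, this.fderiv, gradient, map_smul]
  simp

/-- Young's inequality, absorbing the flux of a test function `η ^ n` into the superlinear gradient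
term. -/
lemma exists_young_absorb {p γ ν cH D : ℝ} (hp : 1 < p) (hγ : p < γ) (hν : 0 < ν) (hcH : 0 < cH)
    (hD : 0 ≤ D) : ∃ C : ℝ, 0 ≤ C ∧ ∃ n : ℕ, 1 ≤ n ∧ ∀ a η d r : ℝ, 0 ≤ a → 0 ≤ η → η ≤ 1 → 0 ≤ d →
      0 < r → d ≤ D / r → ν * a ^ (p - 1) * (n * η ^ (n - 1) * d) ≤
        cH / 2 * (a ^ γ * η ^ n) + C * r ^ (-(γ / (γ - (p - 1)))) := by
  set s := γ / (p - 1) with hs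
  set m := γ / (γ - (p - 1)) with hm
  have hp1 : 0 < p - 1 := by linarith
  have hγ1 : 0 < γ - (p - 1) := by linarith
  have hγ0 : 0 < γ := by linarith
  have hs1 : 1 < s := by rw [hs, one_lt_div hp1]; linarith
  have hm1 : 1 < m := by rw [hm, one_lt_div hγ1]; linarith
  have hsm : s.HolderConjugate m := by
    rw [Real.holderConjugate_iff]
    refine ⟨hs1, ?_⟩
    rw [hs, hm]; field_simp; ring
  -- `n > m` amounts to `(n - 1) * s > n`, so the power of `η` produced by Young's inequality is
  -- dominated by `η ^ n`.
  obtain ⟨n, hn⟩ := exists_nat_gt m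
  have hn1 : 1 < n := by exact_mod_cast hm1.trans hn
  -- This weight gives the gradient power in Young's inequality a coefficient of at most `cH / 2`,
  -- half of the coercive term.
  set κ := (cH / 2) ^ (1 / s) with hκ
  have hκ0 : 0 < κ := by positivity
  have hκs : κ ^ s = cH / 2 := by
    rw [hκ, ← Real.rpow_mul (by positivity), one_div, inv_mul_cancel₀ (by positivity), Real.rpow_one]
  refine ⟨(ν * n * D / κ) ^ m, by positivity, n, hn1.le, fun a η d r ha hη hη1 hd hr hdr => ?_⟩
  have hy := Real.young_inequality_of_nonneg (a := κ * (a ^ (p - 1) * η ^ (n - 1)))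
    (b := ν * n * d / κ) (by positivity) (by positivity) hsm
  have e1 : ν * a ^ (p - 1) * (n * η ^ (n - 1) * d) =
      κ * (a ^ (p - 1) * η ^ (n - 1)) * (ν * n * d / κ) := by field_simp
  rw [e1]
  refine hy.trans (add_le_add ?_ ?_)
  · refine (div_le_self (by positivity) hs1.le).trans ?_
    rw [Real.mul_rpow hκ0.le (by positivity), hκs, Real.mul_rpow (by positivity) (by positivity),
      ← Real.rpow_mul ha, show (p - 1) * s = γ by rw [hs]; field_simp]
    gcongr
    rw [← Real.rpow_natCast, ← Real.rpow_natCast, ← Real.rpow_mul hη]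
    rcases hη.eq_or_lt with rfl | hη0
    · rw [Real.zero_rpow, Real.zero_rpow]
      · positivity
      · have : (0 : ℝ) < ((n - 1 : ℕ) : ℝ) := by
          have : 0 < n - 1 := by omega
          exact_mod_cast this
        positivity
    · refine Real.rpow_le_rpow_of_exponent_ge hη0 hη1 ?_
      rw [Nat.cast_sub hn1.le, Nat.cast_one, hs, mul_div_assoc', le_div_iff₀ hp1]
      have : γ < n * (γ - (p - 1)) := by rwa [hm, div_lt_iff₀ hγ1] at hn
      nlinarith
  · refine (div_le_self (by positivity) hm1.le).trans ?_
    rw [Real.rpow_neg hr.le, ← Real.inv_rpow hr.le, ← Real.mul_rpow (by positivity) (by positivity)]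
    refine Real.rpow_le_rpow (by positivity) ?_ (by positivity)
    calc ν * n * d / κ ≤ ν * n * (D / r) / κ := by gcongr
      _ = ν * n * D / κ * r⁻¹ := by ring

end QuasilinearHolder

namespace QuasilinearHolder

/-! ### Interior energy estimate and Morrey decay of the gradient. -/

lemma integrableOn_of_morreyNorm_le {N : ℕ} {Ω : Set (E N)} {θ : ℝ} {M : ℝ≥0} {G : E N → ℝ}
    (h : morreyNorm Ω 1 θ G ≤ M) (hG : AEStronglyMeasurable G (volume.restrict Ω)) {z : E N}
    (hz : z ∈ Ω) {r : ℝ} (hr : 0 < r) (hrd : r ≤ Metric.diam Ω) :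
    IntegrableOn G (Metric.ball z r ∩ Ω) ∧
      ∫ x in Metric.ball z r ∩ Ω, |G x| ≤ M * r ^ ((N : ℝ) - θ) := by
  have hG' : AEStronglyMeasurable G (volume.restrict (Metric.ball z r ∩ Ω)) :=
    hG.mono_measure (Measure.restrict_mono inter_subset_right le_rfl)
  have h1 : ENNReal.ofReal (r ^ (θ - N)) * eLpNorm G 1 (volume.restrict (Metric.ball z r ∩ Ω)) ≤ M := by
    refine le_trans ?_ h
    unfold morreyNorm
    simp only [div_one, ENNReal.ofReal_one]
    exact le_iSup₂_of_le z hz (le_iSup₂_of_le r ⟨hr, hrd⟩ le_rfl)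
  have hpos : 0 < r ^ (θ - N) := Real.rpow_pos_of_pos hr _
  have h2 : eLpNorm G 1 (volume.restrict (Metric.ball z r ∩ Ω)) ≤
      ENNReal.ofReal (M * r ^ ((N : ℝ) - θ)) := by
    have h3 := mul_le_mul_right h1 (ENNReal.ofReal (r ^ ((N : ℝ) - θ)))
    rw [← mul_assoc, ← ENNReal.ofReal_mul (by positivity), ← Real.rpow_add hr] at h3
    simp only [sub_add_sub_cancel, sub_self, Real.rpow_zero, ENNReal.ofReal_one, one_mul] at h3
    rw [mul_comm (M : ℝ), ENNReal.ofReal_mul (by positivity)]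
    simpa using h3
  have hint : Integrable G (volume.restrict (Metric.ball z r ∩ Ω)) := by
    rw [← memLp_one_iff_integrable]
    exact ⟨hG', h2.trans_lt ENNReal.ofReal_lt_top⟩
  refine ⟨hint, ?_⟩
  have h4 : ∫ x in Metric.ball z r ∩ Ω, |G x| =
      (eLpNorm G 1 (volume.restrict (Metric.ball z r ∩ Ω))).toReal := by
    rw [eLpNorm_one_eq_lintegral_enorm]
    exact integral_norm_eq_lintegral_enorm hG'
  rw [h4]
  exact ENNReal.toReal_le_of_le_ofReal (by positivity) h2

/-- Antipodal points of the closed ball are `4r` apart. This makes the radii used below admissible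
in `morreyNorm`, whose supremum stops at the diameter. -/
lemma four_mul_le_diam {N : ℕ} (hN : 2 ≤ N) {Ω : Set (E N)} (hΩb : Bornology.IsBounded Ω) {z : E N}
    {r : ℝ} (hr : 0 < r) (h : Metric.closedBall z (2 * r) ⊆ Ω) : 4 * r ≤ Metric.diam Ω := by
  have : NeZero N := ⟨by omega⟩
  obtain ⟨e, he⟩ := exists_norm_eq (E N) (c := 2 * r) (by positivity)
  have h1 : z + e ∈ Ω := h (by simp [he])
  have h2 : z - e ∈ Ω := h (by simp [he])
  have h3 := Metric.dist_le_diam_of_mem hΩb h1 h2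
  rw [dist_eq_norm, show z + e - (z - e) = (2 : ℝ) • e by rw [two_smul]; abel, norm_smul, he] at h3
  norm_num at h3
  linarith

/-- Caccioppoli-type estimate: the superlinear gradient term controls the energy on interior balls,
independently of the solution. -/
lemma exists_integral_grad_rpow_le {N : ℕ} (hN : 2 ≤ N) {Ω : Set (E N)} (hΩo : IsOpen Ω)
    (hΩb : Bornology.IsBounded Ω) {p q γ ν cH : ℝ} (hp : 1 < p) (hγ : p < γ)
    (hν : 0 < ν) (hcH : 0 < cH) (M : ℝ≥0) :
    ∃ C : ℝ, 0 ≤ C ∧ ∀ (A : E N → ℝ → E N → E N) (B : E N → ℝ → E N → ℝ) (l : ℝ) (f : E N → ℝ)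
        (u : E N → ℝ) (Du : E N → E N), DiffusionGrowth Ω p ν A →
        0 ≤ l → GradientTermGrowth Ω γ cH l f B →
        AEStronglyMeasurable (fun x => f x + l * max (u x) 0) (volume.restrict Ω) →
        morreyNorm Ω 1 (N / q) (fun x => f x + l * max (u x) 0) ≤ M →
        MemW1Loc Ω γ u Du → IsDistribSupersolution Ω p A B u Du →
        ∀ (z : E N) (r : ℝ), 0 < r → Metric.closedBall z (2 * r) ⊆ Ω →
          ∫ x in Metric.ball z r, ‖Du x‖ ^ γ ≤
            C * (r ^ ((N : ℝ) - γ / (γ - (p - 1))) + r ^ ((N : ℝ) - N / q)) := by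
  obtain ⟨D, hD, hcut⟩ := exists_cutoff N
  obtain ⟨C, hC, n, hn, hyoung⟩ := exists_young_absorb hp hγ hν hcH hD
  set V := volume.real (Metric.ball (0 : E N) 1) with hV
  have hV0 : 0 ≤ V := measureReal_nonneg
  -- `2 / cH` undoes the half left after absorption, `2 ^ N * V` comes from the volume of the ball
  -- of radius `2r`, and the power of `3` from the Morrey bound at radius `3r`.
  refine ⟨2 / cH * (C * 2 ^ N * V + M * 3 ^ ((N : ℝ) - N / q)), by positivity, ?_⟩
  intro A B l f u Du hA hl hB hGm hGM hW hsup z r hr hzr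
  obtain ⟨η, hη, hη0, hη1, hηr, hηs, hηd⟩ := hcut z r hr
  set m := γ / (γ - (p - 1)) with hm
  set S := Metric.closedBall z (2 * r) with hS
  have hSc : IsCompact S := isCompact_closedBall _ _
  have hSm : MeasurableSet S := hSc.measurableSet
  set φ : E N → ℝ := fun x => η x ^ n with hφ
  have hφc : ContDiff ℝ ∞ φ := hη.pow n
  have hφcont : Continuous φ := hφc.continuous
  have hφ0 : ∀ x, 0 ≤ φ x := fun x => pow_nonneg (hη0 x) _
  have hφ1 : ∀ x, φ x ≤ 1 := fun x => pow_le_one₀ (hη0 x) (hη1 x)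
  have hsub : tsupport φ ⊆ S := by
    refine (closure_mono ?_).trans hηs
    intro x hx hx0
    exact hx (by simp only [hφ]; rw [hx0, zero_pow (by omega)])
  have hφcs : HasCompactSupport φ := hSc.of_isClosed_subset (isClosed_tsupport _) hsub
  have hgradcont : Continuous (∇ φ) :=
    (InnerProductSpace.toDual ℝ (E N)).symm.continuous.comp (hφc.continuous_fderiv (by simp))
  have hφS : ∀ x ∉ S, φ x = 0 := fun x hx => image_eq_zero_of_notMem_tsupport fun h => hx (hsub h)
  have hdφS : ∀ x ∉ S, ∇ φ x = 0 := by
    intro x hx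
    have : fderiv ℝ φ x = 0 := image_eq_zero_of_notMem_tsupport
      (fun h => hx (hsub (tsupport_fderiv_subset ℝ h)))
    rw [gradient, this, map_zero]
  have key := hsup.integral_le φ (hφc.of_le (by simp)) hφcs (hsub.trans hzr) hφ0
  rw [setIntegral_eq_of_subset_of_forall_sdiff_eq_zero hΩo.measurableSet hzr
      (fun x hx => by rw [hφS x hx.2, mul_zero]),
    setIntegral_eq_of_subset_of_forall_sdiff_eq_zero hΩo.measurableSet hzr
      (fun x hx => by rw [hdφS x hx.2, inner_zero_right])] at key
  have hrS : volume.restrict S ≤ volume.restrict Ω := Measure.restrict_mono hzr le_rfl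
  -- integrability on `S`
  have hγ0 : 0 < γ := by linarith
  have hDu : IntegrableOn (fun x => ‖Du x‖ ^ γ) S := by
    have := (hW.memLpLoc_grad S hSc hzr).integrable_norm_rpow (by simp [hγ0]) (by simp)
    rwa [ENNReal.toReal_ofReal hγ0.le] at this
  have hDuφ : IntegrableOn (fun x => ‖Du x‖ ^ γ * φ x) S := hDu.mul_continuousOn hφcont.continuousOn hSc
  have hBφ : IntegrableOn (fun x => B x (u x) (Du x) * φ x) S := by
    have := hsup.memLpLoc_term S hSc hzr
    rw [ENNReal.ofReal_one, memLp_one_iff_integrable] at this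
    exact IntegrableOn.mul_continuousOn this hφcont.continuousOn hSc
  have hAi : IntegrableOn (fun x => A x (u x) (Du x)) S := by
    have : IsFiniteMeasure (volume.restrict S) := ⟨by simpa using hSc.measure_lt_top⟩
    refine (hsup.memLpLoc_diffusion S hSc hzr).integrable ?_
    rw [ENNReal.one_le_ofReal, one_le_div (by linarith)]; linarith
  have hAφ : IntegrableOn (fun x => inner ℝ (A x (u x) (Du x)) (∇ φ x)) S := by
    obtain ⟨K, hK⟩ := hSc.exists_bound_of_continuousOn hgradcont.continuousOn
    refine Integrable.mono' (hAi.norm.mul_const K)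
      (hAi.aestronglyMeasurable.inner hgradcont.aestronglyMeasurable) ?_
    filter_upwards [ae_restrict_mem hSm] with x hx
    exact (norm_inner_le_norm _ _).trans (by gcongr; exact hK x hx)
  have hzΩ : z ∈ Ω := hzr (Metric.mem_closedBall_self (by positivity))
  -- The Morrey norm tests open balls: radius `3r` contains the closed ball `S` and still lies below
  -- the diameter.
  have h3 : 3 * r ≤ Metric.diam Ω := by linarith [four_mul_le_diam hN hΩb hr hzr]
  obtain ⟨hGi, hGle⟩ := integrableOn_of_morreyNorm_le hGM hGm hzΩ (by positivity) h3
  have hS3 : S ⊆ Metric.ball z (3 * r) ∩ Ω :=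
    subset_inter (Metric.closedBall_subset_ball (by linarith)) hzr
  have hGS : ∫ x in S, |f x + l * max (u x) 0| ≤ M * (3 * r) ^ ((N : ℝ) - N / q) :=
    (setIntegral_mono_set hGi.abs (ae_of_all _ fun x => abs_nonneg _) hS3.eventuallyLE).trans hGle
  have hGiS : IntegrableOn (fun x => |f x + l * max (u x) 0|) S := (hGi.mono_set hS3).abs
  -- the two pointwise bounds
  have hlow : cH * ∫ x in S, ‖Du x‖ ^ γ * φ x ≤
      (∫ x in S, B x (u x) (Du x) * φ x) + ∫ x in S, |f x + l * max (u x) 0| := by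
    rw [← integral_const_mul, ← integral_add hBφ hGiS]
    refine integral_mono_ae (hDuφ.const_mul _) (hBφ.add hGiS) ?_
    filter_upwards [ae_mono hrS hB] with x hx
    have h1 := mul_le_mul_of_nonneg_right (hx (u x) (Du x)) (hφ0 x)
    have h2 : l * u x ≤ l * max (u x) 0 := by gcongr; exact le_max_left _ _
    have h3 : (f x + l * u x) * φ x ≤ |f x + l * max (u x) 0| := by
      calc (f x + l * u x) * φ x ≤ |f x + l * max (u x) 0| * φ x := by
            refine mul_le_mul_of_nonneg_right ?_ (hφ0 x)
            exact (by linarith : f x + l * u x ≤ f x + l * max (u x) 0).trans (le_abs_self _)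
        _ ≤ _ := mul_le_of_le_one_right (abs_nonneg _) (hφ1 x)
    nlinarith
  have hVS : volume.real S = (2 * r) ^ N * V := by
    rw [hS, hV, Measure.addHaar_real_closedBall _ _ (by positivity)]
    simp
  have hup : ∫ x in S, inner ℝ (A x (u x) (Du x)) (∇ φ x) ≤
      cH / 2 * (∫ x in S, ‖Du x‖ ^ γ * φ x) + C * r ^ (-m) * ((2 * r) ^ N * V) := by
    have hci : IntegrableOn (fun _ : E N => C * r ^ (-m)) S :=
      integrableOn_const hSc.measure_lt_top.ne
    have : C * r ^ (-m) * ((2 * r) ^ N * V) = ∫ x in S, C * r ^ (-m) := by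
      rw [setIntegral_const, hVS, smul_eq_mul, mul_comm]
    rw [this, ← integral_const_mul, ← integral_add (hDuφ.const_mul _) hci]
    refine integral_mono_ae hAφ ((hDuφ.const_mul _).add hci) ?_
    filter_upwards [ae_mono hrS hA] with x hx
    have h1 := hyoung ‖Du x‖ (η x) ‖∇ η x‖ r (norm_nonneg _) (hη0 x) (hη1 x) (norm_nonneg _) hr (hηd x)
    refine le_trans ?_ h1
    refine (real_inner_le_norm _ _).trans ?_
    rw [hφ, gradient_pow (hη.differentiable (by simp)), norm_smul, Real.norm_of_nonneg
      (mul_nonneg (Nat.cast_nonneg _) (pow_nonneg (hη0 x) _))]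
    exact mul_le_mul_of_nonneg_right (hx _ _)
      (mul_nonneg (mul_nonneg (Nat.cast_nonneg _) (pow_nonneg (hη0 x) _)) (norm_nonneg _))
  have hX : ∫ x in Metric.ball z r, ‖Du x‖ ^ γ ≤ ∫ x in S, ‖Du x‖ ^ γ * φ x := by
    have hbS : Metric.ball z r ⊆ S :=
      Metric.ball_subset_closedBall.trans (Metric.closedBall_subset_closedBall (by linarith))
    have : ∫ x in Metric.ball z r, ‖Du x‖ ^ γ = ∫ x in Metric.ball z r, ‖Du x‖ ^ γ * φ x := by
      refine setIntegral_congr_fun Metric.isOpen_ball.measurableSet fun x hx => ?_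
      simp only [hφ]
      rw [hηr x (Metric.ball_subset_closedBall hx), one_pow, mul_one]
    rw [this]
    refine setIntegral_mono_set hDuφ (ae_of_all _ fun x => ?_) hbS.eventuallyLE
    exact mul_nonneg (by positivity) (hφ0 x)
  refine hX.trans ?_
  set X := ∫ x in S, ‖Du x‖ ^ γ * φ x
  have e1 : r ^ (-m) * r ^ N = r ^ ((N : ℝ) - m) := by
    rw [← Real.rpow_natCast, ← Real.rpow_add hr]; congr 1; ring
  have e2 : (3 * r) ^ ((N : ℝ) - N / q) = 3 ^ ((N : ℝ) - N / q) * r ^ ((N : ℝ) - N / q) :=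
    Real.mul_rpow (by norm_num) hr.le
  -- `hlow`, `key` and `hup` are chained. Half of `cH * X` is absorbed on the left, `X` being a
  -- genuine finite integral by `hDuφ`.
  have h5 : cH / 2 * X ≤ C * 2 ^ N * V * r ^ ((N : ℝ) - m) +
      M * 3 ^ ((N : ℝ) - N / q) * r ^ ((N : ℝ) - N / q) := by
    have : C * r ^ (-m) * ((2 * r) ^ N * V) = C * 2 ^ N * V * r ^ ((N : ℝ) - m) := by
      rw [← e1, mul_pow]; ring
    rw [e2, ← mul_assoc] at hGS
    linarith
  have h6 : X = 2 / cH * (cH / 2 * X) := by field_simp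
  rw [h6, mul_assoc (2 / cH)]
  refine mul_le_mul_of_nonneg_left (h5.trans ?_) (by positivity)
  have a1 : 0 ≤ C * 2 ^ N * V := by positivity
  have a2 : 0 ≤ M * (3 : ℝ) ^ ((N : ℝ) - N / q) := by positivity
  have a3 : 0 ≤ r ^ ((N : ℝ) - m) := by positivity
  have a4 : 0 ≤ r ^ ((N : ℝ) - N / q) := by positivity
  nlinarith [mul_nonneg a1 a4, mul_nonneg a2 a3]

/-- The gradient of a solution lies in the Morrey space that yields Hölder continuity. -/
lemma exists_integral_norm_grad_le {N : ℕ} (hN : 2 ≤ N) {Ω : Set (E N)} (hΩo : IsOpen Ω)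
    (hΩb : Bornology.IsBounded Ω) {p q γ ν cH : ℝ} (hp : 1 < p) (hγ : p < γ) (hq₁ : 1 ≤ q)
    (hν : 0 < ν) (hcH : 0 < cH) (M : ℝ≥0) :
    ∃ C : ℝ, 0 ≤ C ∧ ∀ (A : E N → ℝ → E N → E N) (B : E N → ℝ → E N → ℝ) (l : ℝ) (f : E N → ℝ)
        (u : E N → ℝ) (Du : E N → E N), DiffusionGrowth Ω p ν A →
        0 ≤ l → GradientTermGrowth Ω γ cH l f B →
        AEStronglyMeasurable (fun x => f x + l * max (u x) 0) (volume.restrict Ω) →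
        morreyNorm Ω 1 (N / q) (fun x => f x + l * max (u x) 0) ≤ M →
        MemW1Loc Ω γ u Du → IsDistribSupersolution Ω p A B u Du →
        ∀ (z : E N) (r : ℝ), 0 < r → Metric.closedBall z (2 * r) ⊆ Ω →
          ∫ x in Metric.ball z r, ‖Du x‖ ≤
            C * r ^ ((N : ℝ) - 1 + min (1 - N / (q * γ)) ((γ - p) / (γ - (p - 1)))) := by
  obtain ⟨C, hC, hmain⟩ := exists_integral_grad_rpow_le (q := q) hN hΩo hΩb hp hγ hν hcH M
  set α := min (1 - N / (q * γ)) ((γ - p) / (γ - (p - 1))) with hα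
  set V := volume.real (Metric.ball (0 : E N) 1) with hV
  have hV0 : 0 ≤ V := measureReal_nonneg
  have hγ0 : 0 < γ := by linarith
  have hγ1 : 0 < γ - (p - 1) := by linarith
  set d := Metric.diam Ω with hd
  have hd0 : 0 ≤ d := Metric.diam_nonneg
  -- `e₁` and `e₂` are the excesses of the two energy exponents over `N - γ + γ * α`. Both are
  -- nonnegative exactly when `α` is at most each entry of the minimum; the surplus powers of `r`
  -- are then bounded by powers of the diameter.
  set e₁ := γ - γ / (γ - (p - 1)) - γ * α with he₁
  set e₂ := γ - N / q - γ * α with he₂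
  have he₁0 : 0 ≤ e₁ := by
    have h1 : γ * α ≤ γ * ((γ - p) / (γ - (p - 1))) := by gcongr; exact min_le_right _ _
    have h2 : γ * ((γ - p) / (γ - (p - 1))) = γ - γ / (γ - (p - 1)) := by field_simp; ring
    linarith
  have he₂0 : 0 ≤ e₂ := by
    have h1 : γ * α ≤ γ * (1 - N / (q * γ)) := by gcongr; exact min_le_left _ _
    have h2 : γ * (1 - N / (q * γ)) = γ - N / q := by field_simp
    linarith
  refine ⟨(C * (d ^ e₁ + d ^ e₂)) ^ (1 / γ) * V ^ (1 - 1 / γ), by positivity, ?_⟩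
  intro A B l f u Du hA hl hB hGm hGM hW hsup z r hr hzr
  have hle := hmain A B l f u Du hA hl hB hGm hGM hW hsup z r hr hzr
  have hrd : r ≤ d := by linarith [four_mul_le_diam hN hΩb hr hzr]
  have hbS : Metric.ball z r ⊆ Metric.closedBall z (2 * r) :=
      Metric.ball_subset_closedBall.trans (Metric.closedBall_subset_closedBall (by linarith))
  have hle2 : ∫ x in Metric.ball z r, ‖Du x‖ ^ γ ≤
      C * (d ^ e₁ + d ^ e₂) * r ^ ((N : ℝ) - γ + γ * α) := by
    refine hle.trans ?_
    rw [mul_assoc]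
    gcongr
    have h1 : r ^ ((N : ℝ) - γ / (γ - (p - 1))) = r ^ e₁ * r ^ ((N : ℝ) - γ + γ * α) := by
      rw [← Real.rpow_add hr]; congr 1; rw [he₁]; ring
    have h2 : r ^ ((N : ℝ) - N / q) = r ^ e₂ * r ^ ((N : ℝ) - γ + γ * α) := by
      rw [← Real.rpow_add hr]; congr 1; rw [he₂]; ring
    rw [h1, h2, add_mul]
    gcongr
  have hpq : γ.HolderConjugate (1 / (1 - 1 / γ)) := by
    rw [Real.holderConjugate_iff]
    refine ⟨by linarith, ?_⟩
    have : γ - 1 ≠ 0 := by linarith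
    field_simp; ring
  have : IsFiniteMeasure (volume.restrict (Metric.ball z r)) :=
    ⟨by simpa using measure_ball_lt_top⟩
  have hm1 : MemLp (fun x => ‖Du x‖) (ENNReal.ofReal γ) (volume.restrict (Metric.ball z r)) :=
    ((hW.memLpLoc_grad _ (isCompact_closedBall _ _) hzr).mono_measure
      (Measure.restrict_mono hbS le_rfl)).norm
  -- Hölder against the constant `1`: the exponents add up to `(N - γ + γ * α) / γ + N * (1 - 1 / γ)
  -- = N - 1 + α`.
  have hH := integral_mul_le_Lp_mul_Lq_of_nonneg hpq (μ := volume.restrict (Metric.ball z r))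
    (f := fun x => ‖Du x‖) (g := fun _ => 1) (ae_of_all _ fun x => norm_nonneg _)
    (ae_of_all _ fun x => zero_le_one) hm1 (memLp_const 1)
  have hVr : volume.real (Metric.ball z r) = r ^ N * V := by
    rw [hV, measureReal_def, Measure.addHaar_ball_of_pos _ _ hr, ENNReal.toReal_mul,
      ENNReal.toReal_ofReal (by positivity), finrank_euclideanSpace_fin, measureReal_def]
  simp only [mul_one, Real.one_rpow, setIntegral_const, smul_eq_mul, one_div_one_div] at hH
  rw [hVr] at hH
  refine hH.trans ?_
  have hγ2 : 0 ≤ 1 - 1 / γ := by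
    rw [sub_nonneg, div_le_one hγ0]; linarith
  calc (∫ x in Metric.ball z r, ‖Du x‖ ^ γ) ^ (1 / γ) * (r ^ N * V) ^ (1 - 1 / γ)
      ≤ (C * (d ^ e₁ + d ^ e₂) * r ^ ((N : ℝ) - γ + γ * α)) ^ (1 / γ) * (r ^ N * V) ^ (1 - 1 / γ) := by
        gcongr
    _ = (C * (d ^ e₁ + d ^ e₂)) ^ (1 / γ) * V ^ (1 - 1 / γ) *
          (r ^ (((N : ℝ) - γ + γ * α) * (1 / γ)) * r ^ ((N : ℝ) * (1 - 1 / γ))) := by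
        rw [Real.mul_rpow (by positivity) (by positivity), Real.mul_rpow (by positivity) hV0,
          ← Real.rpow_mul hr.le, ← Real.rpow_natCast, ← Real.rpow_mul hr.le]
        ring
    _ = _ := by
        rw [← Real.rpow_add hr]; congr 2; field_simp; ring

end QuasilinearHolder

namespace QuasilinearHolder

/-! ### Mollification of locally integrable functions. -/

section Mollification

open ContinuousLinearMap
open scoped Convolution

variable {N : ℕ}

/-- The standard bump function at scale `ε`, for `ε > 0`. -/
noncomputable def stdBump (N : ℕ) (ε : ℝ) : ContDiffBump (0 : E N) :=
  -- The fixed ratio `2` of the radii gives the kernel bound `ε ^ (-N)` and the a.e. convergence of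
  -- mollifications. `default` is a junk value.
  if h : 0 < ε then ⟨ε / 2, ε, half_pos h, half_lt_self h⟩ else default

/-- The mollification of `u` at scale `ε`. -/
noncomputable def mollify (ε : ℝ) (u : E N → ℝ) : E N → ℝ :=
  u ⋆[lsmul ℝ ℝ, volume] (stdBump N ε).normed volume

lemma stdBump_rOut {ε : ℝ} (hε : 0 < ε) : (stdBump N ε).rOut = ε := by
  rw [stdBump, dif_pos hε]

lemma stdBump_rIn {ε : ℝ} (hε : 0 < ε) : (stdBump N ε).rIn = ε / 2 := by
  rw [stdBump, dif_pos hε]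

/-- Differentiation under the convolution is used with the kernel on the right, the averaging
estimates for `ContDiffBump` with the kernel on the left. -/
lemma mollify_eq_normed_convolution (ε : ℝ) (u : E N → ℝ) (x : E N) :
    mollify ε u x = ((stdBump N ε).normed volume ⋆[lsmul ℝ ℝ, volume] u) x := by
  rw [convolution_lsmul_swap]
  simp only [mollify, convolution_lsmul, smul_eq_mul, mul_comm]

lemma normed_stdBump_le {ε : ℝ} (hε : 0 < ε) (x : E N) :
    (stdBump N ε).normed volume x ≤
      2 ^ N / volume.real (Metric.ball (0 : E N) 1) * ε ^ (-(N : ℝ)) := by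
  refine (ContDiffBump.normed_le_div_measure_closedBall_rIn _ volume x).trans_eq ?_
  rw [stdBump_rIn hε, Measure.addHaar_real_closedBall _ _ (by positivity), finrank_euclideanSpace_fin,
    Real.rpow_neg hε.le, Real.rpow_natCast, div_pow]
  field_simp

lemma normed_stdBump_eq_zero {ε : ℝ} (hε : 0 < ε) {x : E N} (hx : x ∉ Metric.ball (0 : E N) ε) :
    (stdBump N ε).normed volume x = 0 := by
  have := (stdBump N ε).support_normed_eq (μ := volume)
  rw [stdBump_rOut hε] at this
  exact Function.notMem_support.1 (this ▸ hx)

/-- Cutting `u` off outside a compact subset of `Ω` makes it globally integrable, as convolution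
theorems require, without changing its mollification inside. -/
lemma mollify_indicator {ε : ℝ} (hε : 0 < ε) {K : Set (E N)} {x : E N} (h : Metric.ball x ε ⊆ K)
    (u : E N → ℝ) : mollify ε (K.indicator u) x = mollify ε u x := by
  simp only [mollify, convolution_lsmul]
  congr 1
  ext y
  by_cases hy : y ∈ Metric.ball x ε
  · rw [indicator_of_mem (h hy)]
  · rw [normed_stdBump_eq_zero hε, smul_zero, smul_zero]
    simpa [dist_eq_norm, norm_sub_rev] using hy

/-- By associativity both sides convolve `w` with the convolution of the two kernels, which is
symmetric. This allows two scales to be compared through the double mollification. -/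
lemma mollify_mollify_comm {w : E N → ℝ} (hw : Integrable w) (ε δ : ℝ) :
    mollify ε (mollify δ w) = mollify δ (mollify ε w) := by
  have key : ∀ a b : ℝ, ∀ x, mollify b (mollify a w) x = (w ⋆[lsmul ℝ ℝ, volume]
      ((stdBump N a).normed volume ⋆[lsmul ℝ ℝ, volume] (stdBump N b).normed volume)) x := by
    intro a b x
    have ca : HasCompactSupport ((stdBump N a).normed volume) := ContDiffBump.hasCompactSupport_normed _
    have cb : HasCompactSupport ((stdBump N b).normed volume) := ContDiffBump.hasCompactSupport_normed _
    have ka : Continuous ((stdBump N a).normed volume) := ContDiffBump.continuous_normed _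
    have kb : Continuous ((stdBump N b).normed volume) := ContDiffBump.continuous_normed _
    refine convolution_assoc (L := lsmul ℝ ℝ) (L₂ := lsmul ℝ ℝ) (L₃ := lsmul ℝ ℝ) (L₄ := lsmul ℝ ℝ)
      (by intro x y z; simp [mul_assoc]) hw.aestronglyMeasurable ka.aestronglyMeasurable
      kb.aestronglyMeasurable ?_ ?_ ?_
    · exact ae_of_all _ fun y => ca.convolutionExists_right _ hw.locallyIntegrable ka y
    · exact ae_of_all _ fun y => cb.norm.convolutionExists_right _ ka.norm.locallyIntegrable kb.norm y
    · exact (ca.norm.convolution _ cb.norm).convolutionExists_right _ hw.norm.locallyIntegrable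
        (cb.norm.continuous_convolution_right _ ka.norm.locallyIntegrable kb.norm) x
  ext x
  rw [key, key]
  refine congrArg (fun g => (w ⋆[lsmul ℝ ℝ, volume] g) x) (funext fun y => ?_)
  rw [convolution_lsmul_swap, convolution_lsmul]
  simp only [smul_eq_mul, mul_comm]

lemma contDiff_mollify {w : E N → ℝ} (hw : LocallyIntegrable w) (ε : ℝ) :
    ContDiff ℝ 1 (mollify ε w) :=
  (ContDiffBump.hasCompactSupport_normed _).contDiff_convolution_right _ hw
    (ContDiffBump.contDiff_normed _ (n := 1))

lemma integrable_indicator_of_memLpLoc {u : E N → ℝ} {Ω K : Set (E N)} (hu : MemLpLoc u 1 Ω)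
    (hK : IsCompact K) (hKΩ : K ⊆ Ω) : Integrable (K.indicator u) := by
  have := hu K hK hKΩ
  rw [ENNReal.ofReal_one, memLp_one_iff_integrable] at this
  exact (integrable_indicator_iff hK.measurableSet).2 this

/-- The gradient of a mollification is the mollification of the weak gradient. -/
lemma norm_fderiv_mollify_le {Ω : Set (E N)} (hΩo : IsOpen Ω) {u : E N → ℝ} {Du : E N → E N}
    (hu : IsWeakGradient Ω u Du) {x : E N} {ε : ℝ} (hε : 0 < ε)
    (hx : Metric.closedBall x (2 * ε) ⊆ Ω) :
    DifferentiableAt ℝ (mollify ε u) x ∧ ‖fderiv ℝ (mollify ε u) x‖ ≤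
      2 ^ N / volume.real (Metric.ball (0 : E N) 1) * ε ^ (-(N : ℝ)) *
        ∫ y in Metric.ball x ε, ‖Du y‖ := by
  set K := Metric.closedBall x (2 * ε) with hK
  have hKc : IsCompact K := isCompact_closedBall _ _
  set ρ := (stdBump N ε).normed volume with hρ
  set c := 2 ^ N / volume.real (Metric.ball (0 : E N) 1) * ε ^ (-(N : ℝ)) with hc
  have hc0 : 0 ≤ c := by positivity
  have hw := integrable_indicator_of_memLpLoc hu.memLpLoc_fun hKc hx
  set w := K.indicator u with hwdef
  have hρc : ContDiff ℝ ∞ ρ := ContDiffBump.contDiff_normed _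
  have hρs : HasCompactSupport ρ := ContDiffBump.hasCompactSupport_normed _
  -- A derivative needs equality near `x`, not only at `x`; hence the radius `2 * ε` of `K`.
  have hev : mollify ε w =ᶠ[𝓝 x] mollify ε u := by
    filter_upwards [Metric.ball_mem_nhds x hε] with y hy
    refine mollify_indicator hε ?_ u
    exact Metric.ball_subset_closedBall.trans
      (Metric.closedBall_subset_closedBall' (by rw [Metric.mem_ball] at hy; linarith))
  have hd := (hρs.hasFDerivAt_convolution_right (lsmul ℝ ℝ) hw.locallyIntegrable
    (hρc.of_le (by simp)) x).congr_of_eventuallyEq hev.symm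
  refine ⟨hd.differentiableAt, ?_⟩
  rw [hd.fderiv]
  have hI0 : 0 ≤ ∫ y in Metric.ball x ε, ‖Du y‖ := integral_nonneg fun y => norm_nonneg _
  refine opNorm_le_bound _ (mul_nonneg hc0 hI0) fun e => ?_
  rw [convolution_precompR_apply _ hw.locallyIntegrable (hρs.fderiv ℝ) (hρc.continuous_fderiv (by simp)),
    convolution_lsmul]
  -- The reflected kernel is the test function for the weak gradient; the sign from the reflection
  -- cancels the one from integration by parts.
  set φ : E N → ℝ := fun y => ρ (x - y) with hφ
  have hφc : ContDiff ℝ ∞ φ := hρc.comp (contDiff_const.sub contDiff_id)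
  have hφ0 : ∀ y ∉ Metric.ball x ε, φ y = 0 := fun y hy =>
    normed_stdBump_eq_zero hε (by simpa [dist_eq_norm, norm_sub_rev] using hy)
  have hφts : tsupport φ ⊆ K := by
    refine closure_minimal (fun y hy => ?_) Metric.isClosed_closedBall
    have : y ∈ Metric.ball x ε := by_contra fun h => hy (hφ0 y h)
    exact Metric.ball_subset_closedBall.trans (Metric.closedBall_subset_closedBall (by linarith)) this
  have hφcs : HasCompactSupport φ := hKc.of_isClosed_subset (isClosed_tsupport _) hφts
  have hφd : ∀ y, fderiv ℝ ρ (x - y) e = -inner ℝ e (∇ φ y) := by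
    intro y
    have h1 : HasFDerivAt φ ((fderiv ℝ ρ (x - y)).comp (-ContinuousLinearMap.id ℝ (E N))) y :=
      ((hρc.differentiable (by simp)) (x - y)).hasFDerivAt.comp y ((hasFDerivAt_id y).const_sub x)
    rw [real_inner_comm, gradient, InnerProductSpace.toDual_symm_apply, h1.fderiv]
    simp
  have hgradcont : Continuous (∇ φ) :=
    (InnerProductSpace.toDual ℝ (E N)).symm.continuous.comp (hφc.continuous_fderiv (by simp))
  have hdφK : ∀ y ∉ K, ∇ φ y = 0 := by
    intro y hy
    have : fderiv ℝ φ y = 0 := image_eq_zero_of_notMem_tsupport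
      (fun h => hy (hφts (tsupport_fderiv_subset ℝ h)))
    rw [gradient, this, map_zero]
  have huK : IntegrableOn u K := (integrable_indicator_iff hKc.measurableSet).1 hw
  have hug : IntegrableOn (fun y => u y • ∇ φ y) K := huK.smul_continuousOn hgradcont.continuousOn hKc
  have e1 : ∫ y, w y • fderiv ℝ ρ (x - y) e = -inner ℝ e (∫ y in Ω, u y • ∇ φ y) := by
    rw [setIntegral_eq_of_subset_of_forall_sdiff_eq_zero hΩo.measurableSet hx
      (fun y hy => by rw [hdφK y hy.2, smul_zero]), ← integral_inner hug, ← integral_neg,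
      ← integral_indicator hKc.measurableSet]
    congr 1
    ext y
    by_cases hy : y ∈ K
    · rw [hwdef, indicator_of_mem hy, indicator_of_mem hy, hφd, inner_smul_right]
      simp
    · rw [hwdef, indicator_of_notMem hy, indicator_of_notMem hy, zero_smul]
  rw [e1, hu.integral_eq φ hφc hφcs (hφts.trans hx), inner_neg_right, neg_neg]
  refine (norm_inner_le_norm _ _).trans ?_
  rw [mul_comm]
  refine mul_le_mul_of_nonneg_right ?_ (norm_nonneg _)
  have hbK : Metric.ball x ε ⊆ K :=
    Metric.ball_subset_closedBall.trans (Metric.closedBall_subset_closedBall (by linarith))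
  rw [setIntegral_eq_of_subset_of_forall_sdiff_eq_zero hΩo.measurableSet (hbK.trans hx)
      (fun y hy => by rw [hφ0 y hy.2, zero_smul])]
  refine (norm_integral_le_integral_norm _).trans ?_
  rw [← integral_const_mul]
  have hDuK : IntegrableOn Du K := by
    have := hu.memLpLoc_grad K hKc hx
    rwa [ENNReal.ofReal_one, memLp_one_iff_integrable] at this
  refine integral_mono_of_nonneg (ae_of_all _ fun y => norm_nonneg _)
    ((hDuK.mono_set hbK).norm.const_mul _) (ae_of_all _ fun y => ?_)
  simp only [norm_smul]
  refine mul_le_mul_of_nonneg_right ?_ (norm_nonneg _)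
  rw [Real.norm_of_nonneg (ContDiffBump.nonneg_normed _ _)]
  exact normed_stdBump_le hε _

end Mollification

end QuasilinearHolder

namespace QuasilinearHolder

/-! ### Morrey's growth theorem in the interior. -/

section MorreyEmbedding

open ContinuousLinearMap
open scoped Convolution

variable {N : ℕ} {Ω : Set (E N)} {u : E N → ℝ} {Du : E N → E N} {α C₀ : ℝ}

/-- Mean value inequality on a ball: the decay hypothesis bounds the gradient of the mollification
by a multiple of `ε ^ (-N) * ε ^ (N - 1 + α) = ε ^ (α - 1)`. -/
lemma dist_mollify_le (hΩo : IsOpen Ω) (hu : IsWeakGradient Ω u Du)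
    (hD : ∀ (z : E N) (r : ℝ), 0 < r → Metric.closedBall z (2 * r) ⊆ Ω →
      ∫ x in Metric.ball z r, ‖Du x‖ ≤ C₀ * r ^ ((N : ℝ) - 1 + α))
    {x y : E N} {ε : ℝ} (hε : 0 < ε) (hx : Metric.closedBall x (4 * ε) ⊆ Ω) (hy : dist y x ≤ 2 * ε) :
    dist (mollify ε u y) (mollify ε u x) ≤
      2 ^ N / volume.real (Metric.ball (0 : E N) 1) * C₀ * ε ^ (α - 1) * dist y x := by
  have hsub : ∀ z ∈ Metric.closedBall x (2 * ε), Metric.closedBall z (2 * ε) ⊆ Ω := fun z hz =>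
    (Metric.closedBall_subset_closedBall' (by rw [Metric.mem_closedBall] at hz; linarith)).trans hx
  rw [dist_eq_norm, dist_eq_norm]
  refine (convex_closedBall x (2 * ε)).norm_image_sub_le_of_norm_hasFDerivWithin_le (𝕜 := ℝ)
    (f' := fderiv ℝ (mollify ε u))
    (fun z hz => (norm_fderiv_mollify_le hΩo hu hε (hsub z hz)).1.hasFDerivAt.hasFDerivWithinAt)
    (fun z hz => ?_) (Metric.mem_closedBall_self (by positivity)) hy
  refine (norm_fderiv_mollify_le hΩo hu hε (hsub z hz)).2.trans ?_
  refine (mul_le_mul_of_nonneg_left (hD z ε hε (hsub z hz)) (by positivity)).trans_eq ?_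
  have : ε ^ (α - 1) = ε ^ (-(N : ℝ)) * ε ^ ((N : ℝ) - 1 + α) := by
    rw [← Real.rpow_add hε]; congr 1; ring
  rw [this]; ring

/-- The double mollification is an average of each single one over nearby points, so it is close to
both by `dist_mollify_le`. Only gradient bounds for mollifications enter, and no Poincaré inequality
is needed. -/
lemma dist_mollify_half_le (hΩo : IsOpen Ω) (hu : IsWeakGradient Ω u Du) (hα : 0 ≤ α) (hC₀ : 0 ≤ C₀)
    (hD : ∀ (z : E N) (r : ℝ), 0 < r → Metric.closedBall z (2 * r) ⊆ Ω →
      ∫ x in Metric.ball z r, ‖Du x‖ ≤ C₀ * r ^ ((N : ℝ) - 1 + α))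
    {x : E N} {ε : ℝ} (hε : 0 < ε) (hx : Metric.closedBall x (4 * ε) ⊆ Ω) :
    dist (mollify ε u x) (mollify (ε / 2) u x) ≤
      3 * (2 ^ N / volume.real (Metric.ball (0 : E N) 1) * C₀) * ε ^ α := by
  set c := 2 ^ N / volume.real (Metric.ball (0 : E N) 1) * C₀ with hc
  have hc0 : 0 ≤ c := by positivity
  set K := Metric.closedBall x (4 * ε) with hK
  have hw := integrable_indicator_of_memLpLoc hu.memLpLoc_fun (isCompact_closedBall _ _) hx
  set w := K.indicator u with hwdef
  have hsame : ∀ δ, 0 < δ → δ ≤ ε → ∀ y ∈ Metric.ball x ε, mollify δ w y = mollify δ u y := by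
    intro δ hδ hδε y hy
    refine mollify_indicator hδ (Metric.ball_subset_closedBall.trans
      (Metric.closedBall_subset_closedBall' ?_)) u
    rw [Metric.mem_ball] at hy; linarith
  have hx0 : x ∈ Metric.ball x ε := Metric.mem_ball_self hε
  have h2 : 0 < ε / 2 := half_pos hε
  have hpow : ε ^ (α - 1) * ε = ε ^ α := by
    rw [← Real.rpow_add_one hε.ne']; congr 1; ring
  have hA : dist (mollify (ε / 2) (mollify ε w) x) (mollify ε w x) ≤ c * ε ^ (α - 1) * ε := by
    rw [mollify_eq_normed_convolution]
    refine ContDiffBump.dist_normed_convolution_le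
      (contDiff_mollify hw.locallyIntegrable ε).continuous.aestronglyMeasurable fun y hy => ?_
    rw [stdBump_rOut h2] at hy
    have hy' : dist y x ≤ ε := (Metric.mem_ball.1 hy).le.trans (by linarith)
    rw [hsame ε hε le_rfl y (Metric.ball_subset_ball (by linarith) hy), hsame ε hε le_rfl x hx0]
    exact (dist_mollify_le hΩo hu hD hε hx (by linarith)).trans (by gcongr)
  have hB : dist (mollify ε (mollify (ε / 2) w) x) (mollify (ε / 2) w x) ≤
      c * (ε / 2) ^ (α - 1) * ε := by
    rw [mollify_eq_normed_convolution]
    refine ContDiffBump.dist_normed_convolution_le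
      (contDiff_mollify hw.locallyIntegrable _).continuous.aestronglyMeasurable fun y hy => ?_
    rw [stdBump_rOut hε] at hy
    have hy' : dist y x ≤ ε := (Metric.mem_ball.1 hy).le
    rw [hsame _ h2 (by linarith) y hy, hsame _ h2 (by linarith) x hx0]
    exact (dist_mollify_le hΩo hu hD h2
      ((Metric.closedBall_subset_closedBall (by linarith)).trans hx) (by linarith)).trans (by gcongr)
  rw [mollify_mollify_comm hw] at hB
  rw [hsame ε hε le_rfl x hx0] at hA
  rw [hsame _ h2 (by linarith) x hx0] at hB
  -- Valid because `α ≥ 0`; the final factor `3` is `1` from scale `ε` plus this `2` from scale `ε /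
  -- 2`.
  have hhalf : (ε / 2) ^ (α - 1) ≤ 2 * ε ^ (α - 1) := by
    rw [Real.div_rpow hε.le (by norm_num), div_le_iff₀ (by positivity)]
    have : (1 : ℝ) ≤ 2 * 2 ^ (α - 1) := by
      rw [mul_comm, ← Real.rpow_add_one (by norm_num)]
      exact Real.one_le_rpow (by norm_num) (by linarith)
    nlinarith [Real.rpow_pos_of_pos hε (α - 1)]
  have hB' : c * (ε / 2) ^ (α - 1) * ε ≤ 2 * (c * ε ^ α) := by
    calc c * (ε / 2) ^ (α - 1) * ε ≤ c * (2 * ε ^ (α - 1)) * ε := by gcongr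
      _ = 2 * (c * ε ^ α) := by rw [← hpow]; ring
  rw [mul_assoc c, hpow] at hA
  calc _ ≤ dist (mollify (ε / 2) (mollify ε w) x) (mollify ε u x) +
        dist (mollify (ε / 2) (mollify ε w) x) (mollify (ε / 2) u x) := dist_triangle_left _ _ _
    _ ≤ c * ε ^ α + 2 * (c * ε ^ α) := add_le_add hA (hB.trans hB')
    _ = _ := by ring

/-- Lebesgue differentiation for cut-off copies of `u` near each point, glued together because being
null is a local property. -/
lemma tendsto_mollify_ae (hΩo : IsOpen Ω) (hu : MemLpLoc u 1 Ω) {ε : ℕ → ℝ} (hε : ∀ n, 0 < ε n)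
    (hε0 : Tendsto ε atTop (𝓝 0)) :
    ∀ᵐ x ∂(volume.restrict Ω), Tendsto (fun n => mollify (ε n) u x) atTop (𝓝 (u x)) := by
  rw [ae_restrict_iff' hΩo.measurableSet]
  refine measure_null_of_locally_null _ fun x hx => ?_
  have hxΩ : x ∈ Ω := by
    by_contra h
    exact hx fun h' => (h h').elim
  obtain ⟨R, hR, hRΩ⟩ := Metric.nhds_basis_closedBall.mem_iff.1 (hΩo.mem_nhds hxΩ)
  have hw := integrable_indicator_of_memLpLoc hu (isCompact_closedBall x R) hRΩ
  have hconv := ContDiffBump.ae_convolution_tendsto_right_of_locallyIntegrable (μ := volume)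
    (φ := fun n => stdBump N (ε n)) (l := atTop) (K := 2)
    (by simpa only [stdBump_rOut (hε _)] using hε0)
    (Eventually.of_forall fun n => by rw [stdBump_rOut (hε n), stdBump_rIn (hε n)]; linarith)
    hw.locallyIntegrable
  refine ⟨_, inter_mem_nhdsWithin _ (Metric.ball_mem_nhds x (half_pos hR)), ?_⟩
  refine measure_mono_null ?_ hconv
  rintro y ⟨hy, hyR⟩ hy'
  refine hy fun _ => ?_
  have hyK : y ∈ Metric.closedBall x R :=
    Metric.ball_subset_closedBall (Metric.ball_subset_ball (by linarith) hyR)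
  rw [mem_ofPred_eq, indicator_of_mem hyK] at hy'
  refine hy'.congr' ?_
  filter_upwards [hε0.eventually_lt_const (half_pos hR)] with n hn
  rw [← mollify_eq_normed_convolution]
  refine mollify_indicator (hε n) (Metric.ball_subset_closedBall.trans
      (Metric.closedBall_subset_closedBall' ?_)) u
  rw [Metric.mem_ball] at hyR; linarith

/-- Morrey's Dirichlet growth theorem, in the interior of `Ω`. -/
lemma exists_ae_eq_locally_holder (hΩo : IsOpen Ω) (hu : IsWeakGradient Ω u Du) (hα : 0 < α)
    (hα1 : α ≤ 1) (hC₀ : 0 ≤ C₀)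
    (hD : ∀ (z : E N) (r : ℝ), 0 < r → Metric.closedBall z (2 * r) ⊆ Ω →
      ∫ x in Metric.ball z r, ‖Du x‖ ≤ C₀ * r ^ ((N : ℝ) - 1 + α)) {R : ℝ} (hR : 0 < R) :
    ∃ v : E N → ℝ, v =ᵐ[volume.restrict Ω] u ∧
      ∀ x y, dist x y ≤ R → Metric.closedBall x (16 * dist x y) ⊆ Ω →
        |v x - v y| ≤ 2 ^ N / volume.real (Metric.ball (0 : E N) 1) * C₀ *
          (12 / (1 - (1 / 2) ^ α) + 2) * dist x y ^ α := by
  set c := 2 ^ N / volume.real (Metric.ball (0 : E N) 1) * C₀ with hc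
  have hc0 : 0 ≤ c := by positivity
  set ε : ℕ → ℝ := fun n => R * (1 / 2) ^ n with hεdef
  have hε : ∀ n, 0 < ε n := fun n => by positivity
  have hε0 : Tendsto ε atTop (𝓝 0) := by
    have := (tendsto_pow_atTop_nhds_zero_of_lt_one (by norm_num : (0 : ℝ) ≤ 1 / 2)
      (by norm_num)).const_mul R
    rwa [mul_zero] at this
  have hεs : ∀ n, ε (n + 1) = ε n / 2 := fun n => by simp only [hεdef, pow_succ]; ring
  set θ : ℝ := (1 / 2) ^ α with hθ
  have hθ0 : 0 < θ := by positivity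
  have hθ1 : θ < 1 := Real.rpow_lt_one (by norm_num) (by norm_num) hα
  -- geometric convergence
  have hgeo : ∀ k x, Metric.closedBall x (4 * ε k) ⊆ Ω → ∀ j,
      dist (mollify (ε (k + j)) u x) (mollify (ε (k + (j + 1))) u x) ≤ 3 * c * ε k ^ α * θ ^ j := by
    intro k x hx j
    have hkj : ε (k + j) = ε k * (1 / 2) ^ j := by simp only [hεdef, pow_add]; ring
    have hle : ε (k + j) ≤ ε k := by
      rw [hkj]
      exact mul_le_of_le_one_right (hε k).le (pow_le_one₀ (by norm_num) (by norm_num))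
    rw [← add_assoc, hεs]
    refine (dist_mollify_half_le hΩo hu hα.le hC₀ hD (hε _)
      ((Metric.closedBall_subset_closedBall (by linarith)).trans hx)).trans_eq ?_
    rw [← hc, hkj, Real.mul_rpow (hε k).le (by positivity), hθ, ← Real.rpow_natCast,
      ← Real.rpow_natCast, ← Real.rpow_mul (by norm_num), ← Real.rpow_mul (by norm_num),
      mul_comm (j : ℝ)]
    ring
  -- The representative is the limit along dyadic scales. Convergence holds at every point of `Ω`,
  -- with the geometric tail bound below.
  set v : E N → ℝ := fun x => limUnder atTop fun n => mollify (ε n) u x with hv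
  have hlim : ∀ k x, Metric.closedBall x (4 * ε k) ⊆ Ω →
      dist (mollify (ε k) u x) (v x) ≤ 3 * c * ε k ^ α / (1 - θ) := by
    intro k x hx
    have hcs := cauchySeq_of_le_geometric θ _ hθ1 (hgeo k x hx)
    obtain ⟨a, ha⟩ := cauchySeq_tendsto_of_complete hcs
    have ha' : Tendsto (fun n => mollify (ε n) u x) atTop (𝓝 a) := by
      rw [← tendsto_add_atTop_iff_nat k]
      simpa only [add_comm] using ha
    have hva : v x = a := ha'.limUnder_eq
    rw [hva]
    exact dist_le_of_le_geometric_of_tendsto₀ θ _ hθ1 (hgeo k x hx) ha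
  refine ⟨v, ?_, ?_⟩
  · filter_upwards [tendsto_mollify_ae hΩo hu.memLpLoc_fun hε hε0] with x hx
    exact hx.limUnder_eq
  · intro x y hxy hball
    rcases eq_or_ne x y with rfl | hne
    · simp [Real.zero_rpow hα.ne']
    set d := dist x y with hd
    have hd0 : 0 < d := dist_pos.2 hne
    -- The dyadic scale comparable to `d`: `d ≤ ε k < 2 * d`. The balls of radius `4 * ε k` about
    -- `x` and `y` then fit in the ball of radius `16 * d` about `x`. The two tails contribute `6 /
    -- (1 - θ)` each, the middle term `2`.
    obtain ⟨k, hk1, hk2⟩ := exists_nat_pow_near_of_lt_one (div_pos hd0 hR) ((div_le_one hR).2 hxy)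
      (by norm_num : (0 : ℝ) < 1 / 2) (by norm_num)
    have hdk : d ≤ ε k := by
      rw [div_le_iff₀ hR] at hk2; simp only [hεdef]; linarith
    have hkd : ε k ≤ 2 * d := by
      rw [lt_div_iff₀ hR, pow_succ] at hk1; simp only [hεdef]; linarith
    have hx4 : Metric.closedBall x (4 * ε k) ⊆ Ω :=
      (Metric.closedBall_subset_closedBall (by linarith)).trans hball
    have hy4 : Metric.closedBall y (4 * ε k) ⊆ Ω :=
      (Metric.closedBall_subset_closedBall' (by rw [dist_comm]; linarith)).trans hball
    have hpow : ε k ^ α ≤ 2 * d ^ α := by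
      calc ε k ^ α ≤ (2 * d) ^ α := by gcongr
        _ = 2 ^ α * d ^ α := Real.mul_rpow (by norm_num) hd0.le
        _ ≤ 2 * d ^ α := by
          gcongr
          exact (Real.rpow_le_rpow_of_exponent_le (by norm_num) hα1).trans_eq (Real.rpow_one 2)
    have h1 := hlim k x hx4
    have h2 := hlim k y hy4
    have h3 := dist_mollify_le hΩo hu hD (hε k) hx4 (y := y) (by rw [dist_comm]; linarith)
    rw [← hc, dist_comm y x, ← hd] at h3
    have h3' : c * ε k ^ (α - 1) * d ≤ c * ε k ^ α := by
      have : ε k ^ α = ε k ^ (α - 1) * ε k := by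
        rw [← Real.rpow_add_one (hε k).ne']; congr 1; ring
      rw [this, mul_assoc]; gcongr
    have h4 : c * ε k ^ α ≤ c * (2 * d ^ α) := by gcongr
    have h5 : 3 * c * ε k ^ α / (1 - θ) ≤ 6 * c * d ^ α / (1 - θ) := by
      have : 0 < 1 - θ := by linarith
      gcongr ?_ / _
      linarith
    rw [← Real.dist_eq]
    calc dist (v x) (v y) ≤ dist (v x) (mollify (ε k) u x) +
          dist (mollify (ε k) u x) (mollify (ε k) u y) + dist (mollify (ε k) u y) (v y) :=
          dist_triangle4 _ _ _ _
      _ ≤ 6 * c * d ^ α / (1 - θ) + c * (2 * d ^ α) + 6 * c * d ^ α / (1 - θ) := by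
          rw [dist_comm (v x), dist_comm (mollify (ε k) u x) (mollify (ε k) u y)]
          gcongr <;> linarith
      _ = _ := by ring

end MorreyEmbedding

end QuasilinearHolder

namespace QuasilinearHolder

/-! ### From interior scales to a global Hölder estimate. -/

variable {N : ℕ} {Ω : Set (E N)} {C α : ℝ}

/-- Hölder continuity at interior scales: pairs of points that are close to each other in comparison
with their distance to the complement of `Ω`. -/
def IsInteriorHolder (Ω : Set (E N)) (C α : ℝ) (v : E N → ℝ) : Prop :=
  ∀ x y, Metric.closedBall x (16 * dist x y) ⊆ Ω → |v x - v y| ≤ C * dist x y ^ α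

lemma IsInteriorHolder.continuousAt (hΩo : IsOpen Ω) (hα : 0 < α) {v : E N → ℝ}
    (hv : IsInteriorHolder Ω C α v) {x : E N} (hx : x ∈ Ω) : ContinuousAt v x := by
  obtain ⟨r, hr, hrΩ⟩ := Metric.nhds_basis_closedBall.mem_iff.1 (hΩo.mem_nhds hx)
  have h0 : Tendsto (fun y => C * dist x y ^ α) (𝓝 x) (𝓝 0) := by
    have h : Tendsto (fun y => dist x y) (𝓝 x) (𝓝 0) := by
      have : Continuous fun y => dist x y := by fun_prop
      simpa using this.tendsto x
    have := (h.rpow_const (Or.inr hα.le)).const_mul C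
    rwa [Real.zero_rpow hα.ne', mul_zero] at this
  rw [ContinuousAt, tendsto_iff_dist_tendsto_zero]
  refine squeeze_zero' (Eventually.of_forall fun y => dist_nonneg) ?_ h0
  filter_upwards [Metric.ball_mem_nhds x (by positivity : 0 < r / 16)] with y hy
  rw [dist_comm, Real.dist_eq]
  refine hv x y ((Metric.closedBall_subset_closedBall ?_).trans hrΩ)
  rw [Metric.mem_ball, dist_comm] at hy; linarith

/-- Oscillation along the axis of a cone contained in `Ω` with vertex `x`. -/
lemma IsInteriorHolder.dist_cone_le (hΩo : IsOpen Ω) (hα : 0 < α) {v : E N → ℝ}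
    (hv : IsInteriorHolder Ω C α v) {x e : E N} (he : ‖e‖ = 1) {c t : ℝ} (hc : 0 < c) (hc1 : c ≤ 1)
    (ht : 0 ≤ t) (hC : 0 ≤ C)
    (hcone : ∀ s, 0 ≤ s → s ≤ t → Metric.closedBall (x - s • e) (c * s) ⊆ Ω) :
    dist (v (x - t • e)) (v x) ≤ C * t ^ α / (1 - (1 - c / 16) ^ α) := by
  -- Passing from height `s` to `l * s` moves the point by `c * s / 16`, so the ball demanded by the
  -- interior estimate is exactly the cone's ball at height `s`.
  set l := 1 - c / 16 with hl
  have hl0 : 0 < l := by linarith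
  have hl1 : l < 1 := by linarith
  have hxΩ : x ∈ Ω := by
    have := hcone 0 le_rfl ht
    simpa using this
  have hlα : l ^ α < 1 := Real.rpow_lt_one hl0.le hl1 hα
  have hlim : Tendsto (fun k : ℕ => v (x - (l ^ k * t) • e)) atTop (𝓝 (v x)) := by
    refine (hv.continuousAt hΩo hα hxΩ).tendsto.comp ?_
    have h1 := ((tendsto_pow_atTop_nhds_zero_of_lt_one hl0.le hl1).mul_const t).smul_const e
    have h2 := h1.const_sub x
    simpa using h2
  have hstep : ∀ k : ℕ, dist (v (x - (l ^ k * t) • e)) (v (x - (l ^ (k + 1) * t) • e)) ≤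
      C * t ^ α * (l ^ α) ^ k := by
    intro k
    set s := l ^ k * t with hs
    have hs0 : 0 ≤ s := by positivity
    have hst : s ≤ t := mul_le_of_le_one_left ht (pow_le_one₀ hl0.le hl1.le)
    have hd : dist (x - s • e) (x - (l ^ (k + 1) * t) • e) = c / 16 * s := by
      have : x - s • e - (x - (l ^ (k + 1) * t) • e) = (-(c / 16 * s)) • e := by
        rw [pow_succ, hs, hl]; module
      rw [dist_eq_norm, this, norm_smul, he, mul_one, norm_neg, Real.norm_of_nonneg (by positivity)]
    rw [Real.dist_eq]
    refine (hv _ _ ?_).trans ?_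
    · rw [hd]
      exact (Metric.closedBall_subset_closedBall (by linarith)).trans (hcone s hs0 hst)
    · rw [hd, mul_assoc C]
      refine mul_le_mul_of_nonneg_left ?_ hC
      calc (c / 16 * s) ^ α ≤ s ^ α := by
            refine Real.rpow_le_rpow (by positivity) ?_ hα.le
            exact mul_le_of_le_one_left hs0 (by linarith)
        _ = t ^ α * (l ^ α) ^ k := by
            rw [hs, Real.mul_rpow (by positivity) ht, ← Real.rpow_natCast, ← Real.rpow_natCast,
              ← Real.rpow_mul hl0.le, ← Real.rpow_mul hl0.le, mul_comm, mul_comm α]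
  have := dist_le_of_le_geometric_of_tendsto₀ _ _ hlα hstep hlim
  simpa using this

/-- A Lipschitz subgraph satisfies a uniform interior cone condition. -/
lemma closedBall_subset_of_subgraph {e x₀ : E N} {h : (ℝ ∙ e)ᗮ → ℝ} {L : ℝ≥0} {ρ : ℝ}
    (he : ‖e‖ = 1) (hh : LipschitzWith L h)
    (hU : ∀ x ∈ Metric.ball x₀ ρ, x ∈ Ω ↔ inner ℝ e x < h ((ℝ ∙ e)ᗮ.orthogonalProjectionOnto x))
    {x : E N} (hx : x ∈ Metric.ball x₀ (ρ / 4)) (hxΩ : x ∈ Ω) {t : ℝ} (ht : 0 ≤ t) (htρ : t ≤ ρ / 4) :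
    Metric.closedBall (x - t • e) (1 / (1 + L) * t) ⊆ Ω := by
  intro y hy
  set c : ℝ := 1 / (1 + L) with hc
  have hL : (0 : ℝ) < 1 + L := by positivity
  have hc0 : 0 < c := by positivity
  have hc1 : c ≤ 1 := by rw [hc, div_le_one hL]; linarith [L.coe_nonneg]
  -- Descending by `t` compensates for a perturbation of size `c * t`, which raises the height by at
  -- most `c * t` and lowers the graph by at most `L * c * t`.
  have hcL : c + L * c = 1 := by rw [hc]; field_simp
  have hct : c * t ≤ t := mul_le_of_le_one_left ht hc1
  rw [Metric.mem_ball] at hx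
  rw [Metric.mem_closedBall] at hy
  have hyx : dist y x ≤ t + t := by
    refine (dist_triangle y (x - t • e) x).trans ?_
    have : dist (x - t • e) x = t := by
      rw [dist_eq_norm, sub_sub_cancel_left, norm_neg, norm_smul, he, mul_one,
        Real.norm_of_nonneg ht]
    linarith
  have hyU : y ∈ Metric.ball x₀ ρ := by
    rw [Metric.mem_ball]; linarith [dist_triangle y x x₀]
  have hxU : x ∈ Metric.ball x₀ ρ := by
    rw [Metric.mem_ball]; linarith [dist_nonneg (x := x) (y := x₀)]
  rw [hU y hyU]
  have hxlt := (hU x hxU).1 hxΩ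
  set P := (ℝ ∙ e)ᗮ.orthogonalProjectionOnto with hP
  set z := y - (x - t • e) with hz
  have hznorm : ‖z‖ ≤ c * t := by rwa [dist_eq_norm] at hy
  have hPe : P e = 0 := by
    rw [hP, Submodule.orthogonalProjectionOnto_eq_zero_iff, Submodule.orthogonal_orthogonal]
    exact Submodule.mem_span_singleton_self e
  have hyz : y = x - t • e + z := by rw [hz]; abel
  have hPy : P y = P x + P z := by
    rw [hyz, map_add, map_sub, map_smul, hPe, smul_zero, sub_zero]
  have hPz : ‖P z‖ ≤ ‖z‖ := Submodule.norm_orthogonalProjectionOnto_apply_le _ _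
  have hhd : h (P x) - h (P y) ≤ L * (c * t) := by
    have h1 := hh.dist_le_mul (P x) (P y)
    rw [Real.dist_eq, hPy, dist_self_add_right] at h1
    rw [hPy]
    calc _ ≤ L * ‖P z‖ := (le_abs_self _).trans h1
      _ ≤ _ := by gcongr; exact hPz.trans hznorm
  have hin : inner ℝ e y ≤ inner ℝ e x - t + c * t := by
    have h1 : inner ℝ e z ≤ c * t := by
      refine (real_inner_le_norm _ _).trans ?_
      rw [he, one_mul]; exact hznorm
    have h2 : inner ℝ e y = inner ℝ e x - t + inner ℝ e z := by
      rw [hyz, inner_add_right, inner_sub_right, inner_smul_right, real_inner_self_eq_norm_sq, he]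
      ring
    linarith
  have : c * t + L * (c * t) = t := by
    rw [← mul_assoc, ← add_mul, hcL, one_mul]
  linarith

/-- Near a boundary point, both points are pushed inwards along the common direction `e` by a
multiple of their distance. The shifted points form an interior pair, and the two shifts are
controlled by `dist_cone_le`. `K` precedes `v`, so the bound is uniform. -/
lemma exists_nhds_holder (hΩo : IsOpen Ω) (hΩL : HasLipschitzBoundary Ω) (hα : 0 < α) (hC : 0 ≤ C)
    {x₀ : E N} (hx₀ : x₀ ∈ closure Ω) :
    ∃ δ : ℝ, 0 < δ ∧ ∃ K : ℝ, 0 ≤ K ∧ ∀ v, IsInteriorHolder Ω C α v →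
      ∀ x ∈ Metric.ball x₀ δ ∩ Ω, ∀ y ∈ Metric.ball x₀ δ ∩ Ω, |v x - v y| ≤ K * dist x y ^ α := by
  by_cases hx₀Ω : x₀ ∈ Ω
  · obtain ⟨r, hr, hrΩ⟩ := Metric.nhds_basis_closedBall.mem_iff.1 (hΩo.mem_nhds hx₀Ω)
    refine ⟨r / 64, by positivity, C, hC, fun v hv x hx y hy => ?_⟩
    have h1 := Metric.mem_ball.1 hx.1
    have h2 := Metric.mem_ball.1 hy.1
    refine hv x y ((Metric.closedBall_subset_closedBall' ?_).trans hrΩ)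
    linarith [dist_triangle_right x y x₀]
  · obtain ⟨e, h, L, U, he, hh, hU, hUΩ⟩ := hΩL x₀ (by rw [hΩo.frontier_eq]; exact ⟨hx₀, hx₀Ω⟩)
    obtain ⟨ρ, hρ, hρU⟩ := Metric.mem_nhds_iff.1 hU
    set c : ℝ := 1 / (1 + L) with hc
    have hc0 : 0 < c := by positivity
    have hc1 : c ≤ 1 := by
      rw [hc, div_le_one (by positivity)]; linarith [L.coe_nonneg]
    have hD : 0 < 1 - (1 - c / 16) ^ α := by
      linarith [Real.rpow_lt_one (by linarith : 0 ≤ 1 - c / 16) (by linarith) hα]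
    -- Two points of this ball satisfy `d < c * ρ / 64`, which keeps the shift `t = 16 * d / c`
    -- below `ρ / 4`, the height of the available cones.
    refine ⟨c * ρ / 128, by positivity, 2 * (C * (16 / c) ^ α / (1 - (1 - c / 16) ^ α)) + C,
      by positivity, fun v hv x hx y hy => ?_⟩
    have hδ : c * ρ / 128 ≤ ρ / 4 := by nlinarith
    have h1 := Metric.mem_ball.1 hx.1
    have h2 := Metric.mem_ball.1 hy.1
    set d := dist x y with hd
    have hd0 : 0 ≤ d := dist_nonneg
    have hdlt : d < c * ρ / 64 := by linarith [dist_triangle_right x y x₀]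
    set t := 16 / c * d with ht
    have ht0 : 0 ≤ t := by positivity
    have hct : c * t = 16 * d := by rw [ht]; field_simp
    have htρ : t ≤ ρ / 4 := by
      have : c * t ≤ c * (ρ / 4) := by linarith
      exact le_of_mul_le_mul_left this hc0
    have hcone : ∀ z ∈ Metric.ball x₀ (c * ρ / 128) ∩ Ω, ∀ s, 0 ≤ s → s ≤ t →
        Metric.closedBall (z - s • e) (c * s) ⊆ Ω := fun z hz s hs hst =>
      closedBall_subset_of_subgraph he hh (fun w hw => hUΩ w (hρU hw))
        (Metric.ball_subset_ball hδ hz.1) hz.2 hs (hst.trans htρ)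
    have hrad : ∀ z ∈ Metric.ball x₀ (c * ρ / 128) ∩ Ω, dist (v (z - t • e)) (v z) ≤
        C * (16 / c) ^ α / (1 - (1 - c / 16) ^ α) * d ^ α := by
      intro z hz
      refine (hv.dist_cone_le hΩo hα he hc0 hc1 ht0 hC (hcone z hz)).trans_eq ?_
      rw [ht, Real.mul_rpow (by positivity) hd0]; ring
    have hdt : dist (x - t • e) (y - t • e) = d := by rw [dist_sub_right]
    have hhor : dist (v (x - t • e)) (v (y - t • e)) ≤ C * d ^ α := by
      rw [Real.dist_eq]
      have := hv (x - t • e) (y - t • e)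
      rw [hdt, ← hct] at this
      exact this (hcone x hx t ht0 le_rfl)
    rw [← Real.dist_eq]
    calc dist (v x) (v y) ≤ dist (v x) (v (x - t • e)) + dist (v (x - t • e)) (v (y - t • e)) +
          dist (v (y - t • e)) (v y) := dist_triangle4 _ _ _ _
      _ ≤ C * (16 / c) ^ α / (1 - (1 - c / 16) ^ α) * d ^ α + C * d ^ α +
          C * (16 / c) ^ α / (1 - (1 - c / 16) ^ α) * d ^ α := by
        rw [dist_comm (v x)]
        exact add_le_add (add_le_add (hrad x hx) hhor) (hrad y hy)
      _ = _ := by ring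

/-- Along chains of balls, functions that are Hölder continuous at interior scales have oscillation
bounded in terms of the two endpoints only. -/
lemma exists_oscillation_le (hΩo : IsOpen Ω) (hΩc : IsConnected Ω) {a : E N} (ha : a ∈ Ω) {x : E N}
    (hx : x ∈ Ω) : ∃ S : ℝ, ∀ v, IsInteriorHolder Ω C α v → |v x - v a| ≤ S := by
  -- `T` is open and relatively closed in `Ω`, hence all of it. `S` is quantified before `v`, since
  -- the bound must not depend on the function.
  set T : Set (E N) := {x | x ∈ Ω ∧ ∃ S : ℝ, ∀ v, IsInteriorHolder Ω C α v → |v x - v a| ≤ S} with hT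
  have hlink : ∀ x y, Metric.closedBall x (16 * dist x y) ⊆ Ω →
      ((∃ S : ℝ, ∀ v, IsInteriorHolder Ω C α v → |v x - v a| ≤ S) ↔
        ∃ S : ℝ, ∀ v, IsInteriorHolder Ω C α v → |v y - v a| ≤ S) := by
    intro x y hxy
    constructor
    · rintro ⟨S, hS⟩
      refine ⟨C * dist x y ^ α + S, fun v hv => ?_⟩
      have h1 := hv x y hxy
      rw [abs_sub_comm] at h1
      linarith [abs_sub_le (v y) (v x) (v a), hS v hv]
    · rintro ⟨S, hS⟩
      refine ⟨C * dist x y ^ α + S, fun v hv => ?_⟩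
      linarith [abs_sub_le (v x) (v y) (v a), hS v hv, hv x y hxy]
  have hnear : ∀ x ∈ Ω, ∃ r > 0, ∀ y ∈ Metric.ball x r, Metric.closedBall x (16 * dist x y) ⊆ Ω := by
    intro x hx
    obtain ⟨r, hr, hrΩ⟩ := Metric.nhds_basis_closedBall.mem_iff.1 (hΩo.mem_nhds hx)
    refine ⟨r / 16, by positivity, fun y hy => (Metric.closedBall_subset_closedBall ?_).trans hrΩ⟩
    rw [Metric.mem_ball, dist_comm] at hy; linarith
  have hTo : IsOpen T := by
    rw [Metric.isOpen_iff]
    rintro x ⟨hxΩ, hxS⟩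
    obtain ⟨r, hr, hrΩ⟩ := hnear x hxΩ
    refine ⟨r, hr, fun y hy => ⟨?_, (hlink x y (hrΩ y hy)).1 hxS⟩⟩
    refine hrΩ y hy ?_
    rw [Metric.mem_closedBall, dist_comm]
    linarith [dist_nonneg (x := x) (y := y)]
  have hsub : Ω ⊆ T := by
    refine hΩc.isPreconnected.subset_of_closure_inter_subset hTo ⟨a, ha, ha, 0, ?_⟩ ?_
    · intro v _; simp
    · rintro x ⟨hxT, hxΩ⟩
      obtain ⟨r, hr, hrΩ⟩ := hnear x hxΩ
      obtain ⟨y, hyT, hxy⟩ := Metric.mem_closure_iff.1 hxT r hr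
      exact ⟨hxΩ, (hlink x y (hrΩ y (by rwa [Metric.mem_ball, dist_comm]))).2 hyT.2⟩
  exact (hsub hx).2

/-- On a bounded connected Lipschitz domain, Hölder continuity at interior scales is global.
The interior cone condition of a Lipschitz domain suffices here; no sphere condition is needed. -/
lemma exists_holder_of_isInteriorHolder (hΩo : IsOpen Ω) (hΩb : Bornology.IsBounded Ω)
    (hΩc : IsConnected Ω) (hΩL : HasLipschitzBoundary Ω) (hα : 0 < α) (hC : 0 ≤ C) :
    ∃ K : ℝ, 0 ≤ K ∧ ∀ v, IsInteriorHolder Ω C α v →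
      ∀ x ∈ Ω, ∀ y ∈ Ω, |v x - v y| ≤ K * dist x y ^ α := by
  obtain ⟨a, ha⟩ := hΩc.nonempty
  choose! δ hδ K hK hloc using
    fun (x₀ : E N) (hx₀ : x₀ ∈ closure Ω) => exists_nhds_holder hΩo hΩL hα hC hx₀
  obtain ⟨s, hs, hcov⟩ := hΩb.isCompact_closure.elim_nhds_subcover (fun x => Metric.ball x (δ x))
    (fun x hx => Metric.ball_mem_nhds x (hδ x hx))
  -- Pairs closer than the Lebesgue number share one ball of the cover. For the others, the total
  -- oscillation divided by `ε ^ α` serves as Hölder constant.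
  obtain ⟨ε, hε, hleb⟩ := lebesgue_number_lemma_of_metric (ι := s)
    (c := fun i => Metric.ball i.1 (δ i.1)) hΩb.isCompact_closure (fun i => Metric.isOpen_ball)
    (by simpa [iUnion_subtype] using hcov)
  have hne : ∀ x₀ ∈ closure Ω, ∃ S : ℝ, 0 ≤ S ∧ ∀ v, IsInteriorHolder Ω C α v →
      ∀ x ∈ Metric.ball x₀ (δ x₀) ∩ Ω, |v x - v a| ≤ S := by
    intro x₀ hx₀
    obtain ⟨y, hyΩ, hy⟩ := Metric.mem_closure_iff.1 hx₀ (δ x₀) (hδ x₀ hx₀)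
    have hyb : y ∈ Metric.ball x₀ (δ x₀) := by rwa [Metric.mem_ball, dist_comm]
    obtain ⟨S, hS⟩ := exists_oscillation_le (C := C) (α := α) hΩo hΩc ha hyΩ
    refine ⟨K x₀ * (2 * δ x₀) ^ α + |S|, ?_, fun v hv x hx => ?_⟩
    · have := hK x₀ hx₀
      have := hδ x₀ hx₀
      positivity
    · have h1 := hloc x₀ hx₀ v hv x hx y ⟨hyb, hyΩ⟩
      have h2 : dist x y ≤ 2 * δ x₀ := by
        have := Metric.mem_ball.1 hx.1
        have := Metric.mem_ball.1 hyb
        linarith [dist_triangle_right x y x₀]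
      have h3 : K x₀ * dist x y ^ α ≤ K x₀ * (2 * δ x₀) ^ α :=
        mul_le_mul_of_nonneg_left (Real.rpow_le_rpow dist_nonneg h2 hα.le) (hK x₀ hx₀)
      linarith [abs_sub_le (v x) (v y) (v a), hS v hv, le_abs_self S]
  choose! S hS0 hS using hne
  have hKs : 0 ≤ ∑ i ∈ s, K i := Finset.sum_nonneg fun i hi => hK i (hs i hi)
  have hSs : 0 ≤ ∑ i ∈ s, S i := Finset.sum_nonneg fun i hi => hS0 i (hs i hi)
  refine ⟨∑ i ∈ s, K i + 2 * (∑ i ∈ s, S i) / ε ^ α, by positivity, fun v hv x hx y hy => ?_⟩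
  have hosc : ∀ z ∈ Ω, |v z - v a| ≤ ∑ i ∈ s, S i := by
    intro z hz
    obtain ⟨i, hi, hzi⟩ := mem_iUnion₂.1 (hcov (subset_closure hz))
    exact (hS i (hs i hi) v hv z ⟨hzi, hz⟩).trans
      (Finset.single_le_sum (fun j hj => hS0 j (hs j hj)) hi)
  have hd0 : 0 ≤ dist x y ^ α := by positivity
  rw [add_mul]
  rcases lt_or_ge (dist x y) ε with hlt | hge
  · obtain ⟨⟨i, hi⟩, hball⟩ := hleb x (subset_closure hx)
    have h1 := hloc i (hs i hi) v hv x ⟨hball (Metric.mem_ball_self hε), hx⟩ y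
      ⟨hball (by rwa [Metric.mem_ball, dist_comm]), hy⟩
    have h2 : K i * dist x y ^ α ≤ (∑ i ∈ s, K i) * dist x y ^ α :=
      mul_le_mul_of_nonneg_right (Finset.single_le_sum (fun j hj => hK j (hs j hj)) hi) hd0
    have h3 : 0 ≤ 2 * (∑ i ∈ s, S i) / ε ^ α * dist x y ^ α := by positivity
    linarith
  · have h1 : |v x - v y| ≤ 2 * ∑ i ∈ s, S i := by
      have := abs_sub_le (v x) (v a) (v y)
      rw [abs_sub_comm (v a)] at this
      linarith [hosc x hx, hosc y hy]
    have h2 : 2 * ∑ i ∈ s, S i ≤ 2 * (∑ i ∈ s, S i) / ε ^ α * dist x y ^ α := by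
      rw [div_mul_eq_mul_div, le_div_iff₀ (by positivity)]
      gcongr
    have h3 : 0 ≤ (∑ i ∈ s, K i) * dist x y ^ α := by positivity
    linarith

/-- Extension of a real Hölder function from a nonempty set, with the same constant. -/
lemma exists_holder_extension {s : Set (E N)} {a : E N} (ha : a ∈ s) {K : ℝ} (hα : 0 < α)
    (hα1 : α ≤ 1) (hK : 0 ≤ K) {v : E N → ℝ} (hv : ∀ x ∈ s, ∀ y ∈ s, |v x - v y| ≤ K * dist x y ^ α) :
    ∃ w : E N → ℝ, EqOn w v s ∧ ∀ x y, |w x - w y| ≤ K * dist x y ^ α := by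
  -- For `α ≤ 1` the power `dist ^ α` still satisfies the triangle inequality, so the Lipschitz
  -- extension argument applies.
  have htri : ∀ x y z : E N, dist x z ^ α ≤ dist x y ^ α + dist y z ^ α := fun x y z =>
    (Real.rpow_le_rpow dist_nonneg (dist_triangle x y z) hα.le).trans
      (Real.rpow_add_le_add_rpow dist_nonneg dist_nonneg hα.le hα1)
  have : Nonempty s := ⟨⟨a, ha⟩⟩
  have hlow : ∀ x : E N, ∀ y : s, v a - K * dist x a ^ α ≤ v y + K * dist x y ^ α := by
    intro x y
    have h1 := (le_abs_self _).trans (hv a ha y y.2)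
    have h2 := mul_le_mul_of_nonneg_left (htri a x y) hK
    rw [dist_comm a x] at h2
    linarith
  have hbdd : ∀ x : E N, BddBelow (range fun y : s => v y + K * dist x y ^ α) := by
    intro x
    refine ⟨v a - K * dist x a ^ α, ?_⟩
    rintro _ ⟨y, rfl⟩
    exact hlow x y
  -- McShane's formula; comparison with the point `a` keeps the infimum finite.
  refine ⟨fun x : E N => ⨅ y : s, v y + K * dist x (y : E N) ^ α, fun x hx => ?_, ?_⟩
  · refine le_antisymm ?_ (le_ciInf fun y => ?_)
    · refine (ciInf_le (hbdd x) ⟨x, hx⟩).trans_eq ?_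
      simp [Real.zero_rpow hα.ne']
    · have := (le_abs_self _).trans (hv x hx y y.2)
      linarith
  · have hone : ∀ x y : E N, (⨅ z : s, v z + K * dist x z ^ α) - (⨅ z : s, v z + K * dist y z ^ α) ≤
        K * dist x y ^ α := by
      intro x y
      rw [sub_le_comm]
      refine le_ciInf fun z => ?_
      have h1 := ciInf_le (hbdd x) z
      have h2 := mul_le_mul_of_nonneg_left (htri x y z) hK
      linarith
    intro x y
    rw [abs_sub_le_iff]
    refine ⟨hone x y, ?_⟩
    have := hone y x
    rwa [dist_comm y x] at this

end QuasilinearHolder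

/-! ### Assembly of the main theorem. -/

open QuasilinearHolder in
theorem theorem1p1 (N : ℕ) (hN : 2 ≤ N) (Ω : Set (E N)) (hΩo : IsOpen Ω)
    (hΩb : Bornology.IsBounded Ω) (hΩc : IsConnected Ω) (hΩL : HasLipschitzBoundary Ω)
    (hΩS : UniformInteriorSphere Ω)
    (p q γ ν cH : ℝ) (hp : 1 < p) (hγ : p < γ) (hq₁ : 1 ≤ q) (hq : (N : ℝ) / γ < q)
    (hν : 0 < ν) (hcH : 0 < cH) (M : ℝ≥0) :
    -- the constant depends only on the data fixed so far, `M` being a bound for the Morrey norm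
    ∃ K : ℝ,
      ∀ (A : E N → ℝ → E N → E N) (B : E N → ℝ → E N → ℝ) (l : ℝ) (f : E N → ℝ)
        (u : E N → ℝ) (Du : E N → E N),
        IsCaratheodory Ω A → DiffusionGrowth Ω p ν A →
        0 ≤ l → GradientTermGrowth Ω γ cH l f B →
        -- the second alternative is the particular case of data in `L^q`
        ((MemMorrey Ω 1 (N / q) f ∧ MemMorrey Ω 1 (N / q) (fun x => l * max (u x) 0)) ∨
          (MemLp f (ENNReal.ofReal q) (volume.restrict Ω) ∧
            MemLp (fun x => l * max (u x) 0) (ENNReal.ofReal q) (volume.restrict Ω))) →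
        morreyNorm Ω 1 (N / q) (fun x => f x + l * max (u x) 0) ≤ M →
        MemW1Loc Ω γ u Du → IsDistribSupersolution Ω p A B u Du →
        ∃ v : E N → ℝ, v =ᵐ[volume.restrict Ω] u ∧
          ∀ x ∈ closure Ω, ∀ y ∈ closure Ω,
            |v x - v y| ≤ K * ‖x - y‖ ^ min (1 - N / (q * γ)) ((γ - p) / (γ - (p - 1))) := by
  set α := min (1 - N / (q * γ)) ((γ - p) / (γ - (p - 1))) with hα
  have hγ0 : 0 < γ := by linarith
  have hα0 : 0 < α := by
    refine lt_min ?_ (div_pos (by linarith) (by linarith))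
    rw [sub_pos, div_lt_one (by positivity)]
    rwa [div_lt_iff₀ hγ0] at hq
  have hα1 : α ≤ 1 := by
    refine (min_le_right _ _).trans ?_
    rw [div_le_one (by linarith)]; linarith
  obtain ⟨a, ha⟩ := hΩc.nonempty
  have hdiam : 0 < Metric.diam Ω := by
    obtain ⟨r, hr, hrΩ⟩ := Metric.nhds_basis_closedBall.mem_iff.1 (hΩo.mem_nhds ha)
    have := four_mul_le_diam hN hΩb (z := a) (r := r / 2) (by positivity)
      (by rwa [mul_div_cancel₀ r two_ne_zero])
    linarith
  obtain ⟨C₀, hC₀, hgrad⟩ := exists_integral_norm_grad_le hN hΩo hΩb hp hγ hq₁ hν hcH M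
  set C : ℝ := 2 ^ N / volume.real (Metric.ball (0 : E N) 1) * C₀ *
    (12 / (1 - (1 / 2) ^ α) + 2) with hC
  have hC0 : 0 ≤ C := by
    have : 0 < 1 - (1 / 2 : ℝ) ^ α := by
      linarith [Real.rpow_lt_one (by norm_num : (0 : ℝ) ≤ 1 / 2) (by norm_num) hα0]
    positivity
  obtain ⟨K, hK, hglobal⟩ := exists_holder_of_isInteriorHolder hΩo hΩb hΩc hΩL hα0 hC0
  refine ⟨K, fun A B l f u Du _ hA hl hB hdata hM hW hsup => ?_⟩
  -- Either alternative on the data supplies measurability; their size enters through `hM`.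
  have hm : AEStronglyMeasurable (fun x => f x + l * max (u x) 0) (volume.restrict Ω) := by
    rcases hdata with ⟨h1, h2⟩ | ⟨h1, h2⟩
    · exact h1.1.aestronglyMeasurable.add h2.1.aestronglyMeasurable
    · exact h1.aestronglyMeasurable.add h2.aestronglyMeasurable
  obtain ⟨v, hvu, hv⟩ := exists_ae_eq_locally_holder hΩo hW.isWeakGradient hα0 hα1 hC₀
    (hgrad A B l f u Du hA hl hB hm hM hW hsup) hdiam
  have hvi : IsInteriorHolder Ω C α v := by
    intro x y hxy
    refine hv x y (Metric.dist_le_diam_of_mem hΩb ?_ ?_) hxy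
    · exact hxy (Metric.mem_closedBall_self (by positivity))
    · refine hxy ?_
      rw [Metric.mem_closedBall, dist_comm]
      linarith [dist_nonneg (x := x) (y := y)]
  -- `v` is controlled only inside `Ω`; extending its restriction to the whole space covers the
  -- closure.
  obtain ⟨w, hwv, hw⟩ := exists_holder_extension ha hα0 hα1 hK (hglobal v hvi)
  refine ⟨w, ?_, fun x _ y _ => ?_⟩
  · filter_upwards [hvu, ae_restrict_mem hΩo.measurableSet] with x hx hxΩ
    rw [hwv hxΩ, hx]
  · rw [← dist_eq_norm]
    exact hw x y
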